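/- Let $a,b,c\in L^\infty([0,1])$ be real-valued with $a>0$ almost everywhere and $a^{-1}\in L^\infty([0,1])$. Let $H^1([0,1])$ be the space of real functions in $L^2([0,1])$ whose weak derivative on $(0,1)$ belongs to $L^2([0,1])$; point values of $H^1$-functions are those of the continuous representative. Define $A\&B:\operatorname{dom}(A\&B)\subset L^2([0,1])\times\mathbb R\to L^2([0,1])$ and $C\&D:\operatorname{dom}(A\&B)\to\mathbb R$ by \[ \operatorname{dom}(A\&B)=\{(x,u)\in H^1([0,1])\times\mathbb R:\ x(0)=0,\ (ax')'\in L^2([0,1]),\ x(1)=u\}, \] \[ A\&B\,(x,u)=(ax')'+bx'+cx,\qquad C\&D\,(x,u)=(ax')(0), \] where the derivatives are weak derivatives. Then $S=\begin{bmatrix}A\&B\\ C\&D\end{bmatrix}$ is a system node on the triple of real Hilbert spaces $(X,U,Y)=(L^2([0,1]),\mathbb R,\mathbb R)$, that is: (a) the operator $A\&B$ is closed; (b) $C\&D$ is bounded with respect to the graph norm on $\operatorname{dom}(A\&B)$; (c) for every $u\in U$ there is some $x\in X$ with $(x,u)\in\operatorname{dom}(A\&B)$; (d) the main operator $Ax=A\&B\,(x,0)$,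 with domain $\operatorname{dom}(A)=\{x\in X: (x,0)\in\operatorname{dom}(A\&B)\}$, generates a strongly continuous semigroup on $X$. Moreover, the map $S:\operatorname{dom}(S)=\operatorname{dom}(A\&B)\to L^2([0,1])\times\mathbb R$, $(x,u)\mapsto\big(A\&B\,(x,u),\,C\&D\,(x,u)\big)$, is bijective. -/

import Mathlib

open MeasureTheory Set Filter Topology
open scoped ENNReal NNReal ContDiff

/-! ### Strongly continuous semigroups and system nodes -/

/-- A strongly continuous semigroup of bounded linear operators on `X`. -/
structure C0Semigroup (𝕜 X : Type*) [RCLike 𝕜] [NormedAddCommGroup X] [NormedSpace 𝕜 X] where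
  toFun : ℝ≥0 → X →L[𝕜] X
  map_zero : toFun 0 = ContinuousLinearMap.id 𝕜 X
  map_add : ∀ s t : ℝ≥0, toFun (s + t) = (toFun s).comp (toFun t)
  tendsto_zero : ∀ x : X, Tendsto (fun t : ℝ≥0 => toFun t x) (𝓝[>] 0) (𝓝 x)

/-- `A` is the infinitesimal generator of the semigroup `T`: the graph of `A` consists of exactly
the pairs `(x, z)` with `z = lim_{t ↓ 0} t⁻¹ (T t x - x)`. -/
def C0Semigroup.IsGenerator {𝕜 X : Type*} [RCLike 𝕜] [NormedAddCommGroup X] [NormedSpace 𝕜 X]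
    (T : C0Semigroup 𝕜 X) (A : X →ₗ.[𝕜] X) : Prop :=
  ∀ x z : X, (x, z) ∈ A.graph ↔
    Tendsto (fun t : ℝ≥0 => (((t : ℝ) : 𝕜)⁻¹) • (T.toFun t x - x)) (𝓝[>] 0) (𝓝 z)

/-- The main operator `A x = A&B (x, 0)` of `A&B`, with domain `{x | (x, 0) ∈ dom (A&B)}`. -/
def mainOperator {𝕜 X U : Type*} [RCLike 𝕜] [NormedAddCommGroup X] [NormedSpace 𝕜 X]
    [NormedAddCommGroup U] [NormedSpace 𝕜 U] (AB : X × U →ₗ.[𝕜] X) : X →ₗ.[𝕜] X where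
  domain := AB.domain.comap (LinearMap.inl 𝕜 X U)
  toFun := AB.toFun ∘ₗ (LinearMap.inl 𝕜 X U).submoduleComap AB.domain

/-- The pair of `A&B : dom (A&B) ⊆ X × U → X` and `C&D : dom (A&B) → Y` is a system node on
`(X, U, Y)`.  The boundedness of `C&D` is with respect to the graph norm on `dom (A&B)`. -/
structure IsSystemNode {𝕜 X U Y : Type*} [RCLike 𝕜]
    [NormedAddCommGroup X] [InnerProductSpace 𝕜 X] [CompleteSpace X]
    [NormedAddCommGroup U] [InnerProductSpace 𝕜 U] [CompleteSpace U]
    [NormedAddCommGroup Y] [InnerProductSpace 𝕜 Y] [CompleteSpace Y]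
    (AB : X × U →ₗ.[𝕜] X) (CD : AB.domain →ₗ[𝕜] Y) : Prop where
  closed : AB.IsClosed
  bounded : ∃ K : ℝ, ∀ v : AB.domain,
    ‖CD v‖ ≤ K * √(‖v.1.1‖ ^ 2 + ‖v.1.2‖ ^ 2 + ‖AB v‖ ^ 2)
  exists_state : ∀ u : U, ∃ x : X, (x, u) ∈ AB.domain
  generator : ∃ T : C0Semigroup 𝕜 X, T.IsGenerator (mainOperator AB)

/-! ### The Sobolev space `H¹([0,1])` -/

/-- Lebesgue measure on `[0,1]`. -/
noncomputable abbrev volI : Measure ℝ := volume.restrict (Icc (0 : ℝ) 1)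

/-- `L²([0,1])`, real-valued. -/
noncomputable abbrev L2I : Type := Lp ℝ 2 volI

/-- `L^∞([0,1])`, real-valued. -/
noncomputable abbrev LinfI : Type := Lp ℝ ∞ volI

/-- `g` is the weak derivative of `f` on the open interval `(0,1)`. -/
def HasWeakDeriv (f g : L2I) : Prop :=
  ∀ φ : ℝ → ℝ, ContDiff ℝ ∞ φ → HasCompactSupport φ → tsupport φ ⊆ Ioo (0 : ℝ) 1 →
    ∫ ξ, f ξ * deriv φ ξ ∂volI = - ∫ ξ, g ξ * φ ξ ∂volI

theorem integrable_mul_test (f : L2I) {φ : ℝ → ℝ} (hφ : Continuous φ) :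
    Integrable (fun ξ => f ξ * φ ξ) volI := by
  have h1 : MemLp φ 2 volI := by
    obtain ⟨C, hC⟩ := isCompact_Icc.exists_bound_of_continuousOn (s := Icc (0 : ℝ) 1) hφ.continuousOn
    exact MemLp.of_bound hφ.aestronglyMeasurable C
      ((ae_restrict_iff' measurableSet_Icc).2 (Eventually.of_forall hC))
  exact (Lp.memLp f).integrable_mul h1

theorem HasWeakDeriv.add {f₁ f₂ g₁ g₂ : L2I} (h₁ : HasWeakDeriv f₁ g₁) (h₂ : HasWeakDeriv f₂ g₂) :
    HasWeakDeriv (f₁ + f₂) (g₁ + g₂) := by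
  intro φ hφ hc hs
  have hd : Continuous (deriv φ) := hφ.continuous_deriv (by simp)
  have e1 : ∫ ξ, (f₁ + f₂ : L2I) ξ * deriv φ ξ ∂volI
      = ∫ ξ, (f₁ ξ * deriv φ ξ + f₂ ξ * deriv φ ξ) ∂volI := by
    refine integral_congr_ae ?_
    filter_upwards [Lp.coeFn_add f₁ f₂] with ξ h
    rw [h, Pi.add_apply, add_mul]
  have e2 : ∫ ξ, (g₁ + g₂ : L2I) ξ * φ ξ ∂volI = ∫ ξ, (g₁ ξ * φ ξ + g₂ ξ * φ ξ) ∂volI := by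
    refine integral_congr_ae ?_
    filter_upwards [Lp.coeFn_add g₁ g₂] with ξ h
    rw [h, Pi.add_apply, add_mul]
  rw [e1, e2, integral_add (integrable_mul_test _ hd) (integrable_mul_test _ hd),
    integral_add (integrable_mul_test _ hφ.continuous) (integrable_mul_test _ hφ.continuous),
    h₁ φ hφ hc hs, h₂ φ hφ hc hs]
  ring

theorem HasWeakDeriv.smul {f g : L2I} (r : ℝ) (h : HasWeakDeriv f g) :
    HasWeakDeriv (r • f) (r • g) := by
  intro φ hφ hc hs
  have e1 : ∫ ξ, (r • f : L2I) ξ * deriv φ ξ ∂volI = ∫ ξ, r * (f ξ * deriv φ ξ) ∂volI := by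
    refine integral_congr_ae ?_
    filter_upwards [Lp.coeFn_smul r f] with ξ h
    rw [h, Pi.smul_apply, smul_eq_mul, mul_assoc]
  have e2 : ∫ ξ, (r • g : L2I) ξ * φ ξ ∂volI = ∫ ξ, r * (g ξ * φ ξ) ∂volI := by
    refine integral_congr_ae ?_
    filter_upwards [Lp.coeFn_smul r g] with ξ h
    rw [h, Pi.smul_apply, smul_eq_mul, mul_assoc]
  rw [e1, e2, integral_const_mul, integral_const_mul, h φ hφ hc hs]
  ring

/-- A locally integrable function that annihilates all test functions on `(0,1)` vanishes. -/
theorem ae_zero_of_test {F : ℝ → ℝ} (hF : Integrable F volI)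
    (h : ∀ φ : ℝ → ℝ, ContDiff ℝ ∞ φ → HasCompactSupport φ → tsupport φ ⊆ Ioo (0 : ℝ) 1 →
      ∫ ξ, F ξ * φ ξ ∂volI = 0) : F =ᵐ[volI] 0 := by
  have hI : LocallyIntegrableOn F (Ioo (0 : ℝ) 1) volume :=
    (IntegrableOn.mono_set hF Ioo_subset_Icc_self).locallyIntegrableOn
  have := isOpen_Ioo.ae_eq_zero_of_integral_contDiff_smul_eq_zero hI (fun φ h1 h2 h3 => by
    rw [← h φ h1 h2 h3, ← setIntegral_eq_integral_of_forall_compl_eq_zero (s := Icc (0 : ℝ) 1)]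
    · simp [mul_comm]
    · intro x hx
      have : φ x = 0 := image_eq_zero_of_notMem_tsupport fun hx' => hx (Ioo_subset_Icc_self (h3 hx'))
      simp [this])
  change ∀ᵐ x ∂(volume.restrict (Icc (0 : ℝ) 1)), F x = 0
  rw [← restrict_Ioo_eq_restrict_Icc]
  exact (ae_restrict_iff' measurableSet_Ioo).2 this

theorem HasWeakDeriv.unique {f g₁ g₂ : L2I} (h₁ : HasWeakDeriv f g₁) (h₂ : HasWeakDeriv f g₂) :
    g₁ = g₂ := by
  have i (g : L2I) : Integrable g volI := (Lp.memLp g).integrable (by norm_num)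
  have := ae_zero_of_test ((i g₁).sub (i g₂)) (fun φ hφ hc hs => by
    have := h₁ φ hφ hc hs
    rw [h₂ φ hφ hc hs] at this
    simp only [Pi.sub_apply, sub_mul]
    rw [integral_sub (integrable_mul_test _ hφ.continuous) (integrable_mul_test _ hφ.continuous)]
    linarith)
  refine Lp.ext ?_
  filter_upwards [this] with ξ h
  simpa [sub_eq_zero] using h

/-- `H¹([0,1])`, as a subspace of `L²([0,1])`. -/
noncomputable def H1I : Submodule ℝ L2I where
  carrier := {f | ∃ g, HasWeakDeriv f g}
  add_mem' := fun ⟨g₁, h₁⟩ ⟨g₂, h₂⟩ => ⟨g₁ + g₂, h₁.add h₂⟩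
  zero_mem' := ⟨0, fun φ _ _ _ => by
    have h : ∀ ψ : ℝ → ℝ, ∫ ξ, (0 : L2I) ξ * ψ ξ ∂volI = 0 := fun ψ => by
      rw [← integral_zero ℝ ℝ (μ := volI)]
      refine integral_congr_ae ?_
      filter_upwards [Lp.coeFn_zero ℝ 2 volI] with ξ h
      rw [h, Pi.zero_apply, zero_mul]
    rw [h, h, neg_zero]⟩
  smul_mem' := fun r _ ⟨g, h⟩ => ⟨r • g, h.smul r⟩

/-- The weak derivative `H¹([0,1]) → L²([0,1])`. -/
noncomputable def weakDeriv : H1I →ₗ[ℝ] L2I where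
  toFun f := f.2.choose
  map_add' f g := ((f + g).2.choose_spec).unique (f.2.choose_spec.add g.2.choose_spec)
  map_smul' r f := ((r • f).2.choose_spec).unique (f.2.choose_spec.smul r)

theorem hasWeakDeriv_weakDeriv (f : H1I) : HasWeakDeriv f (weakDeriv f) := f.2.choose_spec

theorem integral_volI_eq_interval (F : ℝ → ℝ) : ∫ ξ, F ξ ∂volI = ∫ ξ in (0 : ℝ)..1, F ξ := by
  rw [intervalIntegral.integral_of_le zero_le_one, integral_Icc_eq_integral_Ioc]

theorem integral_volI_eq_of_tsupport {φ : ℝ → ℝ} (hs : tsupport φ ⊆ Ioo (0 : ℝ) 1) :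
    ∫ ξ, φ ξ ∂volI = ∫ ξ, φ ξ :=
  setIntegral_eq_integral_of_forall_compl_eq_zero fun _ hx =>
    image_eq_zero_of_notMem_tsupport fun hx' => hx (Ioo_subset_Icc_self (hs hx'))

/-- A test function on `(0,1)` with vanishing integral is the derivative of a test function. -/
theorem exists_test_primitive {η : ℝ → ℝ} (hη : ContDiff ℝ ∞ η) (hc : HasCompactSupport η)
    (hs : tsupport η ⊆ Ioo (0 : ℝ) 1) (h0 : ∫ ξ in (0 : ℝ)..1, η ξ = 0) :
    ∃ φ : ℝ → ℝ, ContDiff ℝ ∞ φ ∧ HasCompactSupport φ ∧ tsupport φ ⊆ Ioo (0 : ℝ) 1 ∧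
      deriv φ = η := by
  have hd : ∀ t, HasDerivAt (fun t => ∫ s in (0 : ℝ)..t, η s) (η t) t := fun t =>
    hη.continuous.integral_hasStrictDerivAt 0 t |>.hasDerivAt
  have hd' : deriv (fun t => ∫ s in (0 : ℝ)..t, η s) = η := funext fun t => (hd t).deriv
  obtain ⟨α, β, hα, hβ, hαβ⟩ : ∃ α β : ℝ, 0 < α ∧ β < 1 ∧ tsupport η ⊆ Icc α β := by
    rcases (tsupport η).eq_empty_or_nonempty with he | hne
    · exact ⟨1, 0, one_pos, one_pos, by simp [he]⟩
    · obtain ⟨α, hα⟩ := IsCompact.exists_isLeast hc hne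
      obtain ⟨β, hβ⟩ := IsCompact.exists_isGreatest hc hne
      exact ⟨α, β, (hs hα.1).1, (hs hβ.1).2, fun x hx => ⟨hα.2 hx, hβ.2 hx⟩⟩
  have hz : ∀ x, x ∉ Icc α β → η x = 0 := fun x hx =>
    image_eq_zero_of_notMem_tsupport fun hx' => hx (hαβ hx')
  have hsupp : tsupport (fun t => ∫ s in (0 : ℝ)..t, η s) ⊆ Icc α β := by
    refine closure_minimal (fun t ht => ?_) isClosed_Icc
    by_contra hn
    refine ht ?_
    rw [mem_Icc, not_and_or, not_le, not_le] at hn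
    rcases hn with hn | hn
    · change ∫ s in (0 : ℝ)..t, η s = 0
      refine Eq.trans (intervalIntegral.integral_congr (g := fun _ => (0 : ℝ)) ?_)
        intervalIntegral.integral_zero
      refine fun s hs' => hz s fun hs'' => ?_
      have := hs'.2
      have h3 : max 0 t < α := max_lt hα hn
      exact absurd (hs''.1) (not_le.2 (lt_of_le_of_lt this h3))
    · have e := intervalIntegral.integral_add_adjacent_intervals
        (hη.continuous.intervalIntegrable (μ := volume) 0 1)
        (hη.continuous.intervalIntegrable (μ := volume) 1 t)
      have e2 : ∫ s in (1 : ℝ)..t, η s = 0 := by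
        refine Eq.trans (intervalIntegral.integral_congr (g := fun _ => (0 : ℝ)) ?_)
          intervalIntegral.integral_zero
        refine fun s hs' => hz s fun hs'' => ?_
        have h3 : β < min 1 t := lt_min hβ hn
        exact absurd hs''.2 (not_le.2 (lt_of_lt_of_le h3 hs'.1))
      change ∫ s in (0 : ℝ)..t, η s = 0
      rw [← e, h0, e2, add_zero]
  refine ⟨_, ?_, HasCompactSupport.of_support_subset_isCompact isCompact_Icc
    ((subset_tsupport _).trans hsupp),
    hsupp.trans fun x hx => ⟨hα.trans_le hx.1, hx.2.trans_lt hβ⟩, hd'⟩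
  rw [contDiff_infty_iff_deriv, hd']
  exact ⟨fun t => (hd t).differentiableAt, hη⟩

/-- An integrable function on `(0,1)` with vanishing weak derivative is constant. -/
theorem ae_const_of_test {F : ℝ → ℝ} (hF : Integrable F volI)
    (h : ∀ φ : ℝ → ℝ, ContDiff ℝ ∞ φ → HasCompactSupport φ → tsupport φ ⊆ Ioo (0 : ℝ) 1 →
      ∫ ξ, F ξ * deriv φ ξ ∂volI = 0) : ∃ C : ℝ, F =ᵐ[volI] fun _ => C := by
  have hint : ∀ {G : ℝ → ℝ}, Integrable G volI → ∀ {φ : ℝ → ℝ}, Continuous φ →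
      Integrable (fun ξ => G ξ * φ ξ) volI := by
    intro G hG φ hφ
    obtain ⟨K, hK⟩ := isCompact_Icc.exists_bound_of_continuousOn (s := Icc (0 : ℝ) 1)
      hφ.continuousOn
    exact hG.mul_bdd (c := K) hφ.aestronglyMeasurable
      ((ae_restrict_iff' measurableSet_Icc).2 (Eventually.of_forall hK))
  obtain ⟨ψ₀, s0, c0, t0, i0⟩ : ∃ ψ₀ : ℝ → ℝ, ContDiff ℝ ∞ ψ₀ ∧ HasCompactSupport ψ₀ ∧
      tsupport ψ₀ ⊆ Ioo (0 : ℝ) 1 ∧ ∫ ξ, ψ₀ ξ ∂volI = 1 := by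
    let B : ContDiffBump (1 / 2 : ℝ) := ⟨1 / 8, 1 / 4, by norm_num, by norm_num⟩
    have ht : tsupport (B.normed volume) ⊆ Ioo (0 : ℝ) 1 := by
      rw [B.tsupport_normed_eq, Real.closedBall_eq_Icc]
      intro x hx
      have h1 : (1 / 2 - 1 / 4 : ℝ) ≤ x := hx.1
      have h2 : x ≤ (1 / 2 + 1 / 4 : ℝ) := hx.2
      constructor <;> linarith
    exact ⟨B.normed volume, B.contDiff_normed, B.hasCompactSupport_normed, ht, by
      rw [integral_volI_eq_of_tsupport ht, B.integral_normed]⟩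
  refine ⟨∫ ξ, F ξ * ψ₀ ξ ∂volI, ?_⟩
  set C := ∫ ξ, F ξ * ψ₀ ξ ∂volI with hC
  have key := ae_zero_of_test (F := fun ξ => F ξ - C) (hF.sub (integrable_const C))
    (fun ψ hψ hc hs => by
      set m := ∫ ξ, ψ ξ ∂volI with hm
      have hint1 : ∀ {φ : ℝ → ℝ}, Continuous φ → Integrable φ volI := fun hφ => by
        simpa using hint (integrable_const (1 : ℝ)) hφ
      obtain ⟨φ, p1, p2, p3, p4⟩ := exists_test_primitive (η := fun ξ => ψ ξ - m * ψ₀ ξ)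
        (hψ.sub (contDiff_const.mul s0)) (hc.sub c0.mul_left)
        (((tsupport_sub _ _).trans (union_subset_union_right _
          (closure_mono (Function.support_mul_subset_right _ _)))).trans (union_subset hs t0)) (by
          rw [← integral_volI_eq_interval, integral_sub (hint1 hψ.continuous)
            ((hint1 s0.continuous).const_mul m), integral_const_mul, i0, ← hm]
          ring)
      have e := h φ p1 p2 p3
      rw [p4] at e
      have e2 : ∫ ξ, F ξ * (ψ ξ - m * ψ₀ ξ) ∂volI
          = ∫ ξ, F ξ * ψ ξ ∂volI - m * C := by
        rw [hC, ← integral_const_mul, ← integral_sub (hint hF hψ.continuous)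
          ((hint hF s0.continuous).const_mul m)]
        congr 1
        ext ξ
        ring
      rw [e2] at e
      simp only [sub_mul]
      rw [integral_sub (hint hF hψ.continuous) ((hint1 hψ.continuous).const_mul C),
        integral_const_mul, ← hm]
      linarith)
  filter_upwards [key] with ξ hξ
  exact sub_eq_zero.1 hξ

/-- Every element of `H¹([0,1])` has a continuous representative. -/
theorem exists_continuous_rep (f : H1I) : ∃ g : ℝ → ℝ, Continuous g ∧ f.1 =ᵐ[volI] g := by
  have i (g : L2I) : Integrable g volI := (Lp.memLp g).integrable (by norm_num)
  set k : ℝ → ℝ := (Icc (0 : ℝ) 1).indicator (weakDeriv f) with hk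
  have hki : Integrable k := (integrable_indicator_iff measurableSet_Icc).2 (i _)
  set G : ℝ → ℝ := fun t => ∫ s in (0 : ℝ)..t, k s with hG
  have hGc : Continuous G := intervalIntegral.continuous_primitive
    (fun _ _ => hki.intervalIntegrable) 0
  have hGi : Integrable G volI := hGc.continuousOn.integrableOn_compact isCompact_Icc
  have hGac : AbsolutelyContinuousOnInterval G 0 1 :=
    (hki.intervalIntegrable (a := 0) (b := 1)).absolutelyContinuousOnInterval_intervalIntegral
      (by simp)
  obtain ⟨C, hC⟩ := ae_const_of_test (F := fun ξ => f.1 ξ - G ξ) ((i f.1).sub hGi) (by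
    intro φ hφ hc hs
    have hd : Continuous (deriv φ) := hφ.continuous_deriv (by simp)
    have hφac : AbsolutelyContinuousOnInterval φ 0 1 :=
      (hφ.of_le (by simp)).contDiffOn.absolutelyContinuousOnInterval
    have hz : ∀ x, x ∉ Ioo (0 : ℝ) 1 → φ x = 0 := fun x hx =>
      image_eq_zero_of_notMem_tsupport fun hx' => hx (hs hx')
    have e1 := hGac.integral_mul_deriv_eq_deriv_mul hφac
    have e2 : ∫ ξ in (0 : ℝ)..1, deriv G ξ * φ ξ = ∫ ξ in (0 : ℝ)..1, weakDeriv f ξ * φ ξ := by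
      refine intervalIntegral.integral_congr_ae ?_
      filter_upwards [(hki.intervalIntegrable (a := 0) (b := 1)).ae_hasDerivAt_integral]
        with x hx hx1
      have hx2 := uIoc_subset_uIcc hx1
      rw [(hx hx2 0 (by simp)).deriv, hk, indicator_of_mem (by simpa using hx2)]
    rw [hz 0 (by simp), hz 1 (by simp), e2, ← integral_volI_eq_interval,
      ← integral_volI_eq_interval] at e1
    simp only [sub_mul]
    have hGd : Integrable (fun ξ => G ξ * deriv φ ξ) volI :=
      (hGc.mul hd).continuousOn.integrableOn_compact isCompact_Icc
    rw [integral_sub (integrable_mul_test _ hd) hGd,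
      hasWeakDeriv_weakDeriv f φ hφ hc hs, e1]
    ring)
  refine ⟨fun ξ => G ξ + C, hGc.add continuous_const, ?_⟩
  filter_upwards [hC] with ξ hξ
  linarith

/-- Point evaluation of (the continuous representative of) an element of `H¹([0,1])`. -/
noncomputable def evalI (t : Icc (0 : ℝ) 1) : H1I →ₗ[ℝ] ℝ where
  toFun f := (exists_continuous_rep f).choose t
  map_add' f g := by
    have hf := (exists_continuous_rep f).choose_spec
    have hg := (exists_continuous_rep g).choose_spec
    have hs := (exists_continuous_rep (f + g)).choose_spec
    refine Measure.eqOn_Icc_of_ae_eq (μ := volume) zero_ne_one ?_ hs.1.continuousOn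
      (hf.1.add hg.1).continuousOn t.2
    filter_upwards [hf.2, hg.2, hs.2, Lp.coeFn_add f.1 g.1] with ξ h1 h2 h3 h4
    exact h3.symm.trans (h4.trans (congrArg₂ (· + ·) h1 h2))
  map_smul' r f := by
    have hf := (exists_continuous_rep f).choose_spec
    have hs := (exists_continuous_rep (r • f)).choose_spec
    refine Measure.eqOn_Icc_of_ae_eq (μ := volume) zero_ne_one ?_ hs.1.continuousOn
      (hf.1.const_smul r).continuousOn t.2
    filter_upwards [hf.2, hs.2, Lp.coeFn_smul r f.1] with ξ h1 h3 h4
    exact h3.symm.trans (h4.trans (congrArg (r • ·) h1))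

/-- `evalI t f` is the value at `t` of any representative of `f` that is continuous on `[0,1]`. -/
theorem evalI_eq (t : Icc (0 : ℝ) 1) (f : H1I) {g : ℝ → ℝ} (hg : ContinuousOn g (Icc 0 1))
    (hfg : f.1 =ᵐ[volI] g) : evalI t f = g t := by
  have hf := (exists_continuous_rep f).choose_spec
  exact Measure.eqOn_Icc_of_ae_eq (μ := volume) zero_ne_one (hf.2.symm.trans hfg)
    hf.1.continuousOn hg t.2

/-- The value `f(0)` of `f ∈ H¹([0,1])`. -/
noncomputable abbrev eval0 : H1I →ₗ[ℝ] ℝ := evalI ⟨0, by simp⟩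

/-- The value `f(1)` of `f ∈ H¹([0,1])`. -/
noncomputable abbrev eval1 : H1I →ₗ[ℝ] ℝ := evalI ⟨1, by simp⟩

/-! ### The advection-diffusion-reaction operator -/

/-- Multiplication of `L²([0,1])`-functions by a fixed `L^∞([0,1])`-function. -/
noncomputable def mulI (a : LinfI) : L2I →ₗ[ℝ] L2I where
  toFun f := a • f
  map_add' f g := Lp.add_smul a f g
  map_smul' r f := (Lp.smul_comm r a f).symm

/-- The flux `a x'` of `x ∈ H¹([0,1])`. -/
noncomputable def flux (a : LinfI) : H1I →ₗ[ℝ] L2I := mulI a ∘ₗ weakDeriv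

/-- The space of all `x ∈ H¹([0,1])` with `x(0) = 0` and `(a x')' ∈ L²([0,1])`. -/
noncomputable def heatSpace (a : LinfI) : Submodule ℝ H1I :=
  LinearMap.ker eval0 ⊓ H1I.comap (flux a)

/-- `x ↦ a x'` as a map from `heatSpace a` to `H¹([0,1])`. -/
noncomputable def heatFlux (a : LinfI) : heatSpace a →ₗ[ℝ] H1I :=
  ((flux a).domRestrict (heatSpace a)).codRestrict H1I fun x => x.2.2

/-- `dom (A&B)`: all `(x, u)` with `x ∈ H¹([0,1])`, `x(0) = 0`, `(a x')' ∈ L²([0,1])` and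
`x(1) = u`. -/
noncomputable def heatDomain (a : LinfI) : Submodule ℝ (L2I × ℝ) where
  carrier := {v | ∃ x : heatSpace a, (x.1 : L2I) = v.1 ∧ eval1 x.1 = v.2}
  add_mem' := by
    rintro _ _ ⟨x, h1, h2⟩ ⟨y, h3, h4⟩
    exact ⟨x + y, by simp [← h1, ← h3], by simp [← h2, ← h4]⟩
  zero_mem' := ⟨0, by simp, by simp⟩
  smul_mem' := by
    rintro r _ ⟨x, h1, h2⟩
    exact ⟨r • x, by simp [← h1], by simp [← h2]⟩

/-- The first component `(x, u) ↦ x` on `dom (A&B)`. -/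
noncomputable def heatState (a : LinfI) : heatDomain a →ₗ[ℝ] heatSpace a where
  toFun v := v.2.choose
  map_add' v w := by
    refine Subtype.ext (Subtype.ext ?_)
    simp [v.2.choose_spec.1, w.2.choose_spec.1, (v + w).2.choose_spec.1]
  map_smul' r v := by
    refine Subtype.ext (Subtype.ext ?_)
    simp [v.2.choose_spec.1, (r • v).2.choose_spec.1]

/-- `A&B (x, u) = (a x')' + b x' + c x`. -/
noncomputable def heatAB (a b c : LinfI) : L2I × ℝ →ₗ.[ℝ] L2I where
  domain := heatDomain a
  toFun := (weakDeriv ∘ₗ heatFlux a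
    + mulI b ∘ₗ weakDeriv ∘ₗ (heatSpace a).subtype
    + mulI c ∘ₗ H1I.subtype ∘ₗ (heatSpace a).subtype) ∘ₗ heatState a

/-- `C&D (x, u) = (a x')(0)`. -/
noncomputable def heatCD (a b c : LinfI) : (heatAB a b c).domain →ₗ[ℝ] ℝ :=
  eval0 ∘ₗ heatFlux a ∘ₗ heatState a

/-! Put `p = x'` and `q = (ax')'`, and let `V` be integration from `0`. The conditions on `(x, u)`,
the value `f` of `A&B` and the output `y = (ax')(0)` become `x = Vp`, `u = ∫ p`, `ap = y + Vq`, `f =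
q + bp + cx`. If `(f, y)` is given, this is an initial value problem. For `w = ap` and `d = a⁻¹` it
reads `w + Vbdw + VcVdw = Vf + y`, a Volterra equation. An exponential weight makes the norm of `V`
as small as needed, so the equation is uniquely solvable and there is a bounded solution operator `Φ
: (f, y) ↦ (x, u)` (`exists_solution_operator`).

This `Φ` is the inverse of `S`, hence the bijectivity. Closedness of `A&B` and the bound on `C&D`
follow from `(x, u) = Φ(f, 0) + yΦ(0, 1)` with `Φ(0, 1) ≠ 0`.

For the semigroup, integration by parts and Young's inequality give `⟪Ax, x⟫ ≤ κ‖x‖²`. The range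
condition for `r > κ` is a shooting argument: with `c - r` in place of `c`, the endpoint value of
the solution for data `(0, 1)` is nonzero, since otherwise `A` would have an eigenvalue above `κ`.
Hence the initial flux can be tuned to any prescribed `x(1)`, which also gives condition (c).
Generation then follows from the Lumer-Phillips theorem, proved here by Yosida approximation. -/

open scoped RealInnerProductSpace

/-! ### Contraction estimates for exponentials of bounded dissipative operators -/

section BoundedDissipative

variable {X : Type*} [NormedAddCommGroup X] [InnerProductSpace ℝ X] [CompleteSpace X]

theorem hasDerivAt_exp_smul_apply (A : X →L[ℝ] X) (x : X) (t : ℝ) :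
    HasDerivAt (fun s : ℝ => NormedSpace.exp (s • A) x) (NormedSpace.exp (t • A) (A x)) t :=
  by
  simpa using (hasDerivAt_exp_smul_const A t).clm_apply (hasDerivAt_const t x)

theorem hasDerivAt_exp_smul_apply' (A : X →L[ℝ] X) (x : X) (t : ℝ) :
    HasDerivAt (fun s : ℝ => NormedSpace.exp (s • A) x) (A (NormedSpace.exp (t • A) x)) t :=
  by
  simpa using (hasDerivAt_exp_smul_const' A t).clm_apply (hasDerivAt_const t x)

/-- A bounded dissipative operator generates a contraction semigroup. -/
theorem norm_exp_smul_apply_le {A : X →L[ℝ] X} (hA : ∀ x, ⟪A x, x⟫ ≤ 0) {t : ℝ} (ht : 0 ≤ t)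
    (x : X) : ‖NormedSpace.exp (t • A) x‖ ≤ ‖x‖ := by
  have hd : ∀ s : ℝ, HasDerivAt (fun s : ℝ => ‖NormedSpace.exp (s • A) x‖ ^ 2)
      (2 * ⟪NormedSpace.exp (s • A) x, A (NormedSpace.exp (s • A) x)⟫) s := fun s =>
    (hasDerivAt_exp_smul_apply' A x s).norm_sq
  have hanti : Antitone (fun s : ℝ => ‖NormedSpace.exp (s • A) x‖ ^ 2) :=
    antitone_of_deriv_nonpos (fun s => (hd s).differentiableAt) fun s => by
      rw [(hd s).deriv, real_inner_comm]
      linarith [hA (NormedSpace.exp (s • A) x)]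
  have h := hanti ht
  simp only [zero_smul, NormedSpace.exp_zero, one_apply_eq_self] at h
  exact le_of_sq_le_sq h (norm_nonneg _)

/-- The path `s ↦ exp(tB) exp(s(A - B)) x` joins `exp(tB) x` to `exp(tA) x`. By commutativity its
derivative is `exp((t - s)B) exp(sA) (A - B) x`, and both exponentials are contractions for `0 ≤ s ≤
t`. -/
theorem norm_exp_smul_sub_exp_smul_le {A B : X →L[ℝ] X} (hAB : Commute A B)
    (hA : ∀ x, ⟪A x, x⟫ ≤ 0) (hB : ∀ x, ⟪B x, x⟫ ≤ 0) {t : ℝ} (ht : 0 ≤ t) (x : X) :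
    ‖NormedSpace.exp (t • A) x - NormedSpace.exp (t • B) x‖ ≤ t * ‖A x - B x‖ := by
  have e : ∀ s : ℝ, NormedSpace.exp (t • B) * NormedSpace.exp (s • (A - B))
      = NormedSpace.exp ((t - s) • B) * NormedSpace.exp (s • A) := fun s => by
    let _ : NormedAlgebra ℚ (X →L[ℝ] X) := NormedAlgebra.restrictScalars ℚ ℝ _
    rw [← NormedSpace.exp_add_of_commute
        (((hAB.symm.sub_right (Commute.refl B)).smul_left t).smul_right s),
      ← NormedSpace.exp_add_of_commute ((hAB.symm.smul_left (t - s)).smul_right s)]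
    congr 1
    module
  have hd : ∀ s : ℝ, HasDerivAt
      (fun s : ℝ => NormedSpace.exp (t • B) (NormedSpace.exp (s • (A - B)) x))
      (NormedSpace.exp (t • B) (NormedSpace.exp (s • (A - B)) ((A - B) x))) s := fun s =>
    (NormedSpace.exp (t • B)).hasFDerivAt.comp_hasDerivAt s (hasDerivAt_exp_smul_apply (A - B) x s)
  have h := norm_image_sub_le_of_norm_deriv_le_segment' (a := 0) (b := t)
    (C := ‖A x - B x‖) (fun s _ => (hd s).hasDerivWithinAt) (fun s hs => by
      rw [← mul_apply_eq_comp, e s, mul_apply_eq_comp]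
      exact (norm_exp_smul_apply_le hB (sub_nonneg.2 hs.2.le) _).trans
        (norm_exp_smul_apply_le hA hs.1 _)) t ⟨ht, le_rfl⟩
  have e1 := congrArg (fun T : X →L[ℝ] X => T x) (e t)
  simp only [sub_self, zero_smul, NormedSpace.exp_zero, one_mul,
    mul_apply_eq_comp] at e1
  simp only [zero_smul, NormedSpace.exp_zero, one_apply_eq_self, e1, sub_zero] at h
  rw [mul_comm]
  exact h

theorem norm_exp_smul_apply_sub_le {A : X →L[ℝ] X} (hA : ∀ x, ⟪A x, x⟫ ≤ 0) {t : ℝ}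
    (ht : 0 ≤ t) (x : X) : ‖NormedSpace.exp (t • A) x - x‖ ≤ t * ‖A x‖ := by
  simpa using norm_exp_smul_sub_exp_smul_le (Commute.zero_right A) hA (fun x => by simp) ht x

/-- The vector `y` is a substitute for `A x`, so that `A²x` does not occur. The bound therefore
survives passage to an unbounded limit operator, where `A x` may lie outside the domain but can be
approximated by some `y` inside it. -/
theorem norm_exp_smul_apply_sub_sub_le {A : X →L[ℝ] X} (hA : ∀ x, ⟪A x, x⟫ ≤ 0) {t : ℝ}
    (ht : 0 ≤ t) (x y : X) :
    ‖NormedSpace.exp (t • A) x - x - t • A x‖ ≤ t * (2 * ‖A x - y‖ + t * ‖A y‖) := by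
  have hd : ∀ s : ℝ, HasDerivAt (fun s : ℝ => NormedSpace.exp (s • A) x - s • A x)
      (NormedSpace.exp (s • A) (A x) - A x) s := fun s => by
    have h := (hasDerivAt_exp_smul_apply A x s).sub ((hasDerivAt_id s).smul_const (A x))
    rw [one_smul] at h
    exact h
  have h := norm_image_sub_le_of_norm_deriv_le_segment' (a := 0) (b := t)
    (C := 2 * ‖A x - y‖ + t * ‖A y‖) (fun s _ => (hd s).hasDerivWithinAt) (fun s hs => by
      have e : NormedSpace.exp (s • A) (A x) - A x
          = NormedSpace.exp (s • A) (A x - y) + (NormedSpace.exp (s • A) y - y) + (y - A x) := by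
        rw [map_sub]; abel
      rw [e]
      have h1 := norm_exp_smul_apply_le hA hs.1 (A x - y)
      have h2 := norm_exp_smul_apply_sub_le hA hs.1 y
      have h3 : s * ‖A y‖ ≤ t * ‖A y‖ := by gcongr; exact hs.2.le
      have h4 := norm_add₃_le (a := NormedSpace.exp (s • A) (A x - y))
        (b := NormedSpace.exp (s • A) y - y) (c := y - A x)
      rw [norm_sub_rev y] at h4
      linarith) t ⟨ht, le_rfl⟩
  simp only [zero_smul, NormedSpace.exp_zero, one_apply_eq_self, sub_zero] at h
  rw [mul_comm, sub_right_comm]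
  exact h

end BoundedDissipative

theorem tendsto_of_dense_of_norm_sub_le {X : Type*} [SeminormedAddCommGroup X] {ι : Type*} {l : Filter ι} {F : ι → X → X} {G : X → X}
    {D : Set X} (hD : Dense D) (hF : ∀ᶠ i in l, ∀ x y, ‖F i x - F i y‖ ≤ ‖x - y‖)
    (hG : ∀ x y, ‖G x - G y‖ ≤ ‖x - y‖)
    (h : ∀ x ∈ D, Tendsto (fun i => F i x) l (𝓝 (G x))) (x : X) :
    Tendsto (fun i => F i x) l (𝓝 (G x)) := by
  rw [Metric.tendsto_nhds]
  intro ε hε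
  obtain ⟨y, hy, hxy⟩ := Metric.dense_iff.1 hD x (ε / 3) (by positivity)
  rw [Metric.mem_ball, dist_comm, dist_eq_norm] at hy
  filter_upwards [hF, Metric.tendsto_nhds.1 (h y hxy) (ε / 3) (by positivity)] with i h1 h2
  rw [dist_eq_norm] at h2 ⊢
  have e : F i x - G x = (F i x - F i y) + (F i y - G y) + (G y - G x) := by abel
  have h3 := norm_add₃_le (a := F i x - F i y) (b := F i y - G y) (c := G y - G x)
  have h4 := h1 x y
  have h5 := hG y x
  rw [norm_sub_rev y x] at h5
  rw [e]
  linarith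

/-! ### Limits of semigroups with commuting dissipative generators -/

section Limit

variable {X : Type*} [NormedAddCommGroup X] [InnerProductSpace ℝ X] [CompleteSpace X]

/-- The semigroups generated by commuting bounded dissipative operators converge if the operators
converge on a dense set. -/
theorem exists_tendsto_exp_smul {A : ℕ → X →L[ℝ] X} (hc : ∀ m n, Commute (A m) (A n))
    (hA : ∀ n x, ⟪A n x, x⟫ ≤ 0) {D : Set X} (hD : Dense D)
    (hAD : ∀ x ∈ D, ∃ z, Tendsto (fun n => A n x) atTop (𝓝 z)) {t : ℝ} (ht : 0 ≤ t) :
    ∃ T : X →L[ℝ] X, ∀ x,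
      Tendsto (fun n => NormedSpace.exp (t • A n) x) atTop (𝓝 (T x)) := by
  have hcauchy : ∀ x, CauchySeq (fun n => NormedSpace.exp (t • A n) x) := by
    intro x
    rw [Metric.cauchySeq_iff']
    intro ε hε
    obtain ⟨y, hy, hyD⟩ := Metric.dense_iff.1 hD x (ε / 3) (by positivity)
    rw [Metric.mem_ball, dist_eq_norm] at hy
    obtain ⟨z, hz⟩ := hAD y hyD
    have hz' : CauchySeq (fun n => t • A n y) := (hz.const_smul t).cauchySeq
    obtain ⟨N, hN⟩ := Metric.cauchySeq_iff'.1 hz' (ε / 3) (by positivity)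
    refine ⟨N, fun n hn => ?_⟩
    have h1 := hN n hn
    rw [dist_eq_norm, ← smul_sub, norm_smul, Real.norm_of_nonneg ht] at h1
    -- Commutation bounds the difference at `y ∈ D` by `t‖A n y - A N y‖`; contractivity carries
    -- this over to the nearby point `x`.
    have h2 := norm_exp_smul_sub_exp_smul_le (hc n N) (hA n) (hA N) ht y
    have h3 := norm_exp_smul_apply_le (hA n) ht (x - y)
    have h4 := norm_exp_smul_apply_le (hA N) ht (y - x)
    rw [norm_sub_rev x y] at h3
    rw [dist_eq_norm]
    have e : NormedSpace.exp (t • A n) x - NormedSpace.exp (t • A N) x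
        = NormedSpace.exp (t • A n) (x - y)
          + (NormedSpace.exp (t • A n) y - NormedSpace.exp (t • A N) y)
          + NormedSpace.exp (t • A N) (y - x) := by
      rw [map_sub, map_sub]; abel
    rw [e]
    refine (norm_add₃_le).trans_lt ?_
    linarith
  choose f hf using fun x => cauchySeq_tendsto_of_complete (hcauchy x)
  exact ⟨continuousLinearMapOfTendsto (fun n => NormedSpace.exp (t • A n))
    (tendsto_pi_nhds.2 hf), hf⟩

end Limit

/-! ### Generation theorems of Lumer-Phillips type -/

section Generation

variable {X : Type*} [NormedAddCommGroup X] [InnerProductSpace ℝ X]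

theorem C0Semigroup.isGenerator_iff_real {T : C0Semigroup ℝ X} {A : X →ₗ.[ℝ] X} :
    T.IsGenerator A ↔ ∀ x z : X, (x, z) ∈ A.graph ↔
      Tendsto (fun t : ℝ≥0 => (t : ℝ)⁻¹ • (T.toFun t x - x)) (𝓝[>] 0) (𝓝 z) := by
  simp [C0Semigroup.IsGenerator]

theorem tendsto_coe_nhdsGT_zero : Tendsto (fun t : ℝ≥0 => (t : ℝ)) (𝓝[>] 0) (𝓝 0) :=
  NNReal.continuous_coe.continuousWithinAt.tendsto

/-- The derivative at zero of a contraction semigroup is dissipative. -/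
theorem C0Semigroup.inner_le_zero_of_tendsto {T : C0Semigroup ℝ X}
    (hT : ∀ t x, ‖T.toFun t x‖ ≤ ‖x‖) {x z : X}
    (h : Tendsto (fun t : ℝ≥0 => (t : ℝ)⁻¹ • (T.toFun t x - x)) (𝓝[>] 0) (𝓝 z)) :
    ⟪z, x⟫ ≤ 0 := by
  refine le_of_tendsto (h.inner tendsto_const_nhds) (Eventually.of_forall fun t => ?_)
  rw [real_inner_smul_left, inner_sub_left, real_inner_self_eq_norm_sq]
  have h1 := real_inner_le_norm (T.toFun t x) x
  have h2 := mul_le_mul_of_nonneg_right (hT t x) (norm_nonneg x)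
  exact mul_nonpos_of_nonneg_of_nonpos (by positivity) (by nlinarith)

/-- A vector orthogonal to the domain has the form `μx - Ax`. Pairing it with `x` gives `μ‖x‖² =
⟪Ax, x⟫ ≤ 0`, so it vanishes. -/
theorem dense_domain_of_dissipative [CompleteSpace X] {A : X →ₗ.[ℝ] X} {μ : ℝ} (hμ : 0 < μ)
    (hA : ∀ x : A.domain, ⟪A x, (x : X)⟫ ≤ 0)
    (hs : ∀ f : X, ∃ x : A.domain, μ • (x : X) - A x = f) : Dense (A.domain : Set X) := by
  rw [Submodule.dense_iff_topologicalClosure_eq_top, Submodule.topologicalClosure_eq_top_iff,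
    Submodule.eq_bot_iff]
  intro z hz
  obtain ⟨x, rfl⟩ := hs z
  have h := (Submodule.mem_orthogonal' _ _).1 hz x x.2
  rw [inner_sub_left, real_inner_smul_left, real_inner_self_eq_norm_sq] at h
  have h1 : ‖(x : X)‖ ^ 2 ≤ 0 := by nlinarith [hA x]
  have h2 : x = 0 := by
    have := pow_eq_zero_iff (two_ne_zero) |>.1 (le_antisymm h1 (sq_nonneg _))
    exact Subtype.ext (norm_eq_zero.1 this)
  simp [h2]

/-- The resolvent of a maximal dissipative operator. -/
theorem exists_resolvent_of_dissipative {A : X →ₗ.[ℝ] X} {μ : ℝ} (hμ : 0 < μ)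
    (hA : ∀ x : A.domain, ⟪A x, (x : X)⟫ ≤ 0)
    (hs : ∀ f : X, ∃ x : A.domain, μ • (x : X) - A x = f) :
    ∃ R : X →L[ℝ] X, (∀ f, μ * ‖R f‖ ≤ ‖f‖) ∧ (∀ x : A.domain, R (μ • (x : X) - A x) = x) ∧
      ∀ f, ∃ x : A.domain, R f = x ∧ μ • (x : X) - A x = f := by
  -- Dissipativity gives `μ‖x‖² ≤ ⟪μx - Ax, x⟫`. This lower bound yields injectivity, hence
  -- linearity of the inverse, as well as the resolvent estimate.
  have hb : ∀ x : A.domain, μ * ‖(x : X)‖ ≤ ‖μ • (x : X) - A x‖ := by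
    intro x
    have h := real_inner_le_norm (μ • (x : X) - A x) x
    rw [inner_sub_left, real_inner_smul_left, real_inner_self_eq_norm_sq] at h
    rcases (norm_nonneg (x : X)).eq_or_lt with h0 | h0
    · rw [← h0, mul_zero]; positivity
    · refine le_of_mul_le_mul_right ?_ h0
      nlinarith [hA x]
  have hinj : ∀ x y : A.domain, μ • (x : X) - A x = μ • (y : X) - A y → x = y := by
    intro x y h
    have h1 := hb (x - y)
    have e : μ • ((x - y : A.domain) : X) - A (x - y) = 0 := by
      rw [LinearPMap.map_sub, Submodule.coe_sub, smul_sub, sub_sub_sub_comm, h, sub_self]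
    rw [e, norm_zero] at h1
    have h2 : ‖((x - y : A.domain) : X)‖ = 0 :=
      le_antisymm (nonpos_of_mul_nonpos_right h1 hμ) (norm_nonneg _)
    exact sub_eq_zero.1 (Subtype.ext (norm_eq_zero.1 h2))
  choose r hr using hs
  let R : X →ₗ[ℝ] X :=
    { toFun := fun f => r f
      map_add' := fun f g => by
        have : r (f + g) = r f + r g := hinj _ _ (by
          rw [hr, LinearPMap.map_add, Submodule.coe_add, smul_add, add_sub_add_comm, hr, hr])
        rw [this, Submodule.coe_add]
      map_smul' := fun k f => by
        have : r (k • f) = k • r f := hinj _ _ (by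
          rw [hr, LinearPMap.map_smul, Submodule.coe_smul, smul_comm, ← smul_sub, hr])
        rw [this, Submodule.coe_smul, RingHom.id_apply] }
  have hR : ∀ f, μ * ‖R f‖ ≤ ‖f‖ := fun f => (hb (r f)).trans_eq (by rw [hr])
  refine ⟨R.mkContinuous μ⁻¹ fun f => ?_, hR, fun x => ?_, fun f => ⟨r f, rfl, hr f⟩⟩
  · rw [inv_mul_eq_div, le_div_iff₀' hμ]
    exact hR f
  · change ((r (μ • (x : X) - A x) : A.domain) : X) = x
    rw [hinj _ x (hr _)]

/-- An operator that is approximated on its dense domain by commuting bounded dissipative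
operators generates a contraction semigroup if its range condition holds. -/
theorem exists_isGenerator_of_approx [CompleteSpace X] {A : X →ₗ.[ℝ] X} {B : ℕ → X →L[ℝ] X}
    (hc : ∀ m n, Commute (B m) (B n)) (hB : ∀ n x, ⟪B n x, x⟫ ≤ 0)
    (hD : Dense (A.domain : Set X))
    (hBA : ∀ x : A.domain, Tendsto (fun n => B n x) atTop (𝓝 (A x)))
    (hs : ∀ f : X, ∃ x : A.domain, (x : X) - A x = f) :
    ∃ T : C0Semigroup ℝ X, T.IsGenerator A := by
  choose S hS using fun t : ℝ≥0 =>
    exists_tendsto_exp_smul hc hB hD (fun x hx => ⟨_, hBA ⟨x, hx⟩⟩) t.2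
  have hS' : ∀ (t : ℝ≥0) x,
      Tendsto (fun n => NormedSpace.exp ((t : ℝ) • B n) x) atTop (𝓝 (S t x)) := hS
  have hcontr : ∀ t x, ‖S t x‖ ≤ ‖x‖ := fun t x =>
    le_of_tendsto' (hS' t x).norm fun n => norm_exp_smul_apply_le (hB n) t.2 x
  have hadd : ∀ s t : ℝ≥0, S (s + t) = (S s).comp (S t) := by
    intro s t
    ext x
    refine tendsto_nhds_unique (hS' (s + t) x) ?_
    -- Uniform contractivity allows the inner orbit to be replaced by its limit `S t x`, so the
    -- semigroup law passes to the limit.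
    have h1 : Tendsto (fun n => NormedSpace.exp ((s : ℝ) • B n)
        (NormedSpace.exp ((t : ℝ) • B n) x - S t x)) atTop (𝓝 0) :=
      squeeze_zero_norm (fun n => norm_exp_smul_apply_le (hB n) s.2 _)
        (tendsto_iff_norm_sub_tendsto_zero.1 (hS' t x))
    have h2 := h1.add (hS' s (S t x))
    rw [zero_add] at h2
    refine h2.congr fun n => ?_
    let _ : NormedAlgebra ℚ (X →L[ℝ] X) := NormedAlgebra.restrictScalars ℚ ℝ _
    rw [← map_add, sub_add_cancel, ← mul_apply_eq_comp, ← NormedSpace.exp_add_of_commute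
      (((Commute.refl (B n)).smul_left (s : ℝ)).smul_right (t : ℝ)), ← add_smul, NNReal.coe_add]
  have hlip : ∀ (t : ℝ≥0) (x : A.domain), ‖S t x - x‖ ≤ t * ‖A x‖ := fun t x =>
    le_of_tendsto_of_tendsto' ((hS' t x).sub_const _).norm ((hBA x).norm.const_mul _)
      fun n => norm_exp_smul_apply_sub_le (hB n) t.2 x
  have hest : ∀ (t : ℝ≥0) (x y : A.domain),
      ‖S t x - x - (t : ℝ) • A x‖ ≤ t * (2 * ‖A x - y‖ + t * ‖A y‖) := fun t x y =>
    le_of_tendsto_of_tendsto' (((hS' t x).sub_const _).sub ((hBA x).const_smul (t : ℝ))).norm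
      (((((hBA x).sub_const _).norm.const_mul _).add ((hBA y).norm.const_mul _)).const_mul _)
      fun n => norm_exp_smul_apply_sub_sub_le (hB n) t.2 x y
  let T : C0Semigroup ℝ X :=
    { toFun := S
      map_zero := by
        ext x
        refine tendsto_nhds_unique (hS' 0 x) ?_
        simp
      map_add := hadd
      tendsto_zero := fun x => by
        refine tendsto_of_dense_of_norm_sub_le (G := id) hD
          (Eventually.of_forall fun t x y => ?_) (fun x y => le_rfl) (fun y hy => ?_) x
        · rw [← map_sub]; exact hcontr t _
        · refine tendsto_iff_norm_sub_tendsto_zero.2 (squeeze_zero (fun _ => norm_nonneg _)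
            (fun t => hlip t ⟨y, hy⟩) ?_)
          simpa using tendsto_coe_nhdsGT_zero.mul_const ‖A ⟨y, hy⟩‖ }
  have hderiv : ∀ x : A.domain,
      Tendsto (fun t : ℝ≥0 => (t : ℝ)⁻¹ • (S t x - x)) (𝓝[>] 0) (𝓝 (A x)) := by
    intro x
    rw [Metric.tendsto_nhds]
    intro ε hε
    -- The remainder estimate counts `‖A x - y‖` twice, so `ε / 4` leaves `ε / 2` for the term `t‖A
    -- y‖`.
    obtain ⟨y, hy, hyD⟩ := Metric.dense_iff.1 hD (A x) (ε / 4) (by positivity)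
    rw [Metric.mem_ball, dist_comm, dist_eq_norm] at hy
    have h0 : Tendsto (fun t : ℝ≥0 => (t : ℝ) * ‖A ⟨y, hyD⟩‖) (𝓝[>] 0) (𝓝 0) := by
      simpa using tendsto_coe_nhdsGT_zero.mul_const ‖A ⟨y, hyD⟩‖
    filter_upwards [h0.eventually_lt_const (show 0 < ε / 2 by positivity), self_mem_nhdsWithin]
      with t ht ht0
    have ht1 : (0 : ℝ) < t := ht0
    have h1 := hest t x ⟨y, hyD⟩
    have e : (t : ℝ)⁻¹ • (S t x - x) - A x = (t : ℝ)⁻¹ • (S t x - x - (t : ℝ) • A x) := by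
      rw [smul_sub _ _ ((t : ℝ) • A x), inv_smul_smul₀ ht1.ne']
    rw [dist_eq_norm, e, norm_smul, norm_inv, Real.norm_of_nonneg ht1.le, inv_mul_lt_iff₀ ht1]
    refine h1.trans_lt ?_
    gcongr
    linarith
  refine ⟨T, C0Semigroup.isGenerator_iff_real.2 fun x z => ⟨fun h => ?_, fun h => ?_⟩⟩
  · obtain ⟨y, rfl, rfl⟩ := (LinearPMap.mem_graph_iff A).1 h
    exact hderiv y
  -- The generator cannot properly extend `A`: with `y - Ay = x - z`, the orbit of `x - y` has
  -- derivative `x - y` at zero, and dissipativity forces `‖x - y‖² ≤ 0`.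
  · obtain ⟨y, hy⟩ := hs (x - z)
    have h1 : Tendsto (fun t : ℝ≥0 => (t : ℝ)⁻¹ • (T.toFun t (x - y) - (x - y)))
        (𝓝[>] 0) (𝓝 (x - y)) := by
      have h2 := h.sub (hderiv y)
      rw [show z - A y = x - y by rw [sub_eq_iff_eq_add.1 hy]; abel] at h2
      refine h2.congr fun t => ?_
      rw [← smul_sub, map_sub]
      congr 1
      change T.toFun t x - x - (T.toFun t y - y) = _
      abel
    have h3 := T.inner_le_zero_of_tendsto hcontr h1
    have h4 : x = y := sub_eq_zero.1 (real_inner_self_nonpos.1 h3)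
    have h5 : z = A y := by
      rw [h4] at hy
      exact (sub_right_injective hy).symm
    rw [h4, h5]
    exact A.mem_graph y

/-- The Lumer-Phillips theorem for contraction semigroups on a Hilbert space. -/
theorem exists_isGenerator_of_dissipative [CompleteSpace X] {A : X →ₗ.[ℝ] X}
    (hA : ∀ x : A.domain, ⟪A x, (x : X)⟫ ≤ 0)
    (hs : ∀ μ : ℝ, 0 < μ → ∀ f : X, ∃ x : A.domain, μ • (x : X) - A x = f) :
    ∃ T : C0Semigroup ℝ X, T.IsGenerator A := by
  have hD := dense_domain_of_dissipative one_pos hA (hs 1 one_pos)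
  have hpos : ∀ n : ℕ, (0 : ℝ) < n + 1 := fun n => by positivity
  choose R hRb hRl hRr using fun n : ℕ =>
    exists_resolvent_of_dissipative (hpos n) hA (hs _ (hpos n))
  have hRA : ∀ (n : ℕ) (x : A.domain), ((n : ℝ) + 1) • R n x - x = R n (A x) := fun n x => by
    have := hRl n x
    rw [map_sub, map_smul] at this
    rw [sub_eq_iff_eq_add] at this ⊢
    rw [this, add_comm]
  have hcontr : ∀ (n : ℕ) x, ‖((n : ℝ) + 1) • R n x‖ ≤ ‖x‖ := fun n x => by
    rw [norm_smul, Real.norm_of_nonneg (hpos n).le]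
    exact hRb n x
  -- This is the resolvent identity; exchanging `m` and `n` in it shows that the resolvents commute.
  have hid : ∀ m n f, R n f - R m f = ((m : ℝ) - n) • R m (R n f) := fun m n f => by
    obtain ⟨x, hx, hf⟩ := hRr n f
    have := hRA m x
    rw [hx]
    have e : R m (A x) = R m (((n : ℝ) + 1) • (x : X) - f) := by rw [← hf]; congr 1; abel
    rw [e, map_sub, map_smul] at this
    calc (x : X) - R m f
        = ((m : ℝ) + 1) • R m x - ((n : ℝ) + 1) • R m x
          - ((((m : ℝ) + 1) • R m x - x) - (((n : ℝ) + 1) • R m x - R m f)) := by abel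
      _ = ((m : ℝ) - n) • R m x := by rw [this]; module
  have hRc : ∀ m n, Commute (R m) (R n) := fun m n => by
    rcases eq_or_ne m n with rfl | hmn
    · exact Commute.refl _
    · ext f
      have h1 := hid m n f
      have h2 := hid n m f
      rw [← neg_sub, h1, ← neg_smul, neg_sub] at h2
      exact smul_right_injective X (sub_ne_zero.2 (Nat.cast_injective.ne hmn.symm)) h2
  have hJ : ∀ y : X, Tendsto (fun n : ℕ => ((n : ℝ) + 1) • R n y) atTop (𝓝 y) := fun y => by
    refine tendsto_of_dense_of_norm_sub_le (F := fun (n : ℕ) y => ((n : ℝ) + 1) • R n y) (G := id) hD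
      (Eventually.of_forall fun n x y => ?_) (fun x y => le_rfl) (fun y hy => ?_) y
    · rw [← smul_sub, ← map_sub]; exact hcontr n _
    · refine tendsto_iff_norm_sub_tendsto_zero.2 (squeeze_zero (fun _ => norm_nonneg _)
        (g := fun n : ℕ => ‖A ⟨y, hy⟩‖ * (1 / ((n : ℝ) + 1))) (fun n => ?_) ?_)
      · have := hRA n ⟨y, hy⟩
        rw [id, this, mul_one_div, le_div_iff₀' (hpos n)]
        exact hRb n _
      · simpa using tendsto_one_div_add_atTop_nhds_zero_nat.const_mul ‖A ⟨y, hy⟩‖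
  -- These are the Yosida approximations at `μ = n + 1`, the shift keeping `μ` positive. On the
  -- domain they equal `μ R A x`, which tends to `A x` by `hJ`.
  refine exists_isGenerator_of_approx
    (B := fun n => ((n : ℝ) + 1) • (((n : ℝ) + 1) • R n - 1)) (fun m n => ?_) (fun n x => ?_) hD
    (fun x => ?_) (fun f => by simpa using hs 1 one_pos f)
  · refine Commute.smul_left (Commute.smul_right ?_ _) _
    exact (((hRc m n).smul_left _).smul_right _ |>.sub_left (Commute.one_left _)).sub_right
      (Commute.one_right _)
  · change ⟪((n : ℝ) + 1) • (((n : ℝ) + 1) • R n x - x), x⟫ ≤ 0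
    rw [real_inner_smul_left, inner_sub_left, real_inner_self_eq_norm_sq]
    have h1 := real_inner_le_norm (((n : ℝ) + 1) • R n x) x
    have h2 := mul_le_mul_of_nonneg_right (hcontr n x) (norm_nonneg x)
    exact mul_nonpos_of_nonneg_of_nonpos (hpos n).le (by nlinarith)
  · refine (hJ (A x)).congr fun n => ?_
    rw [← hRA n x]
    rfl

/-- The rescaled semigroup `exp (κ t) T t`. -/
noncomputable def C0Semigroup.rescale (T : C0Semigroup ℝ X) (κ : ℝ) : C0Semigroup ℝ X where
  toFun t := Real.exp (κ * t) • T.toFun t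
  map_zero := by simp [T.map_zero]
  map_add s t := by
    ext x
    simp [T.map_add, mul_add, Real.exp_add, smul_smul, mul_comm]
  tendsto_zero x := by
    have h : Tendsto (fun t : ℝ≥0 => Real.exp (κ * t)) (𝓝[>] 0) (𝓝 1) := by
      simpa [Function.comp_def] using (Real.continuous_exp.tendsto _).comp (tendsto_coe_nhdsGT_zero.const_mul κ)
    simpa using h.smul (T.tendsto_zero x)

theorem C0Semigroup.tendsto_rescale (T : C0Semigroup ℝ X) (κ : ℝ) {x z : X}
    (h : Tendsto (fun t : ℝ≥0 => (t : ℝ)⁻¹ • (T.toFun t x - x)) (𝓝[>] 0) (𝓝 z)) :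
    Tendsto (fun t : ℝ≥0 => (t : ℝ)⁻¹ • ((T.rescale κ).toFun t x - x)) (𝓝[>] 0)
      (𝓝 (z + κ • x)) := by
  have h1 : Tendsto (fun t : ℝ≥0 => Real.exp (κ * t)) (𝓝[>] 0) (𝓝 1) := by
    simpa [Function.comp_def] using (Real.continuous_exp.tendsto _).comp (tendsto_coe_nhdsGT_zero.const_mul κ)
  have h2 : Tendsto (fun t : ℝ≥0 => (t : ℝ)⁻¹ * (Real.exp (κ * t) - 1)) (𝓝[>] 0) (𝓝 κ) := by
    have hd : HasDerivAt (fun t : ℝ => Real.exp (κ * t)) κ 0 := by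
      simpa using ((hasDerivAt_id (0 : ℝ)).const_mul κ).exp
    have h3 := hd.tendsto_slope_zero_right
    have h4 : Tendsto (fun t : ℝ≥0 => (t : ℝ)) (𝓝[>] 0) (𝓝[>] 0) :=
      tendsto_nhdsWithin_of_tendsto_nhds_of_eventually_within _ tendsto_coe_nhdsGT_zero
        (by filter_upwards [self_mem_nhdsWithin] with t ht using ht)
    simpa [Function.comp_def] using h3.comp h4
  have h3 := (h1.smul h).add (h2.smul_const x)
  rw [one_smul] at h3
  refine h3.congr fun t => ?_
  change _ = (t : ℝ)⁻¹ • (Real.exp (κ * t) • T.toFun t x - x)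
  module

/-- The Lumer-Phillips theorem for quasi-contraction semigroups on a Hilbert space. -/
theorem exists_isGenerator_of_quasidissipative [CompleteSpace X] {A : X →ₗ.[ℝ] X} {κ : ℝ}
    (hA : ∀ x : A.domain, ⟪A x, (x : X)⟫ ≤ κ * ‖(x : X)‖ ^ 2)
    (hs : ∀ μ : ℝ, κ < μ → ∀ f : X, ∃ x : A.domain, μ • (x : X) - A x = f) :
    ∃ T : C0Semigroup ℝ X, T.IsGenerator A := by
  let A' : X →ₗ.[ℝ] X := ⟨A.domain, A.toFun - κ • A.domain.subtype⟩
  have hA' : ∀ x : A.domain, A' x = A x - κ • (x : X) := fun x => rfl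
  obtain ⟨T, hT⟩ := exists_isGenerator_of_dissipative (A := A') (fun x => by
      change A.domain at x
      rw [hA' x, inner_sub_left, real_inner_smul_left, real_inner_self_eq_norm_sq]
      linarith [hA x]) (fun μ hμ f => by
      obtain ⟨x, hx⟩ := hs (μ + κ) (by linarith) f
      refine ⟨x, ?_⟩
      rw [hA' x, ← hx]
      module)
  rw [C0Semigroup.isGenerator_iff_real] at hT
  have hg : ∀ x z : X, (x, z) ∈ A.graph ↔ (x, z - κ • x) ∈ A'.graph := by
    intro x z
    rw [LinearPMap.mem_graph_iff, LinearPMap.mem_graph_iff]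
    constructor
    · rintro ⟨y, rfl, rfl⟩
      exact ⟨y, rfl, rfl⟩
    · rintro ⟨y, rfl, hy⟩
      change A.domain at y
      exact ⟨y, rfl, sub_left_injective hy⟩
  refine ⟨T.rescale κ, C0Semigroup.isGenerator_iff_real.2 fun x z => ?_⟩
  rw [hg, hT]
  constructor
  · intro h
    simpa using T.tendsto_rescale κ h
  · intro h
    -- Rescaling by `-κ` undoes the first rescaling, so the converse needs no separate computation.
    have h1 := (T.rescale κ).tendsto_rescale (-κ) h
    rw [neg_smul, ← sub_eq_add_neg] at h1
    refine h1.congr fun t => ?_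
    change (t : ℝ)⁻¹ • (Real.exp (-κ * t) • Real.exp (κ * t) • T.toFun t x - x) = _
    rw [smul_smul, ← Real.exp_add]
    simp

end Generation

/-! ### Primitives of integrable functions and integration by parts -/

section Primitive

theorem integrable_volI_of_L2I (f : L2I) : Integrable f volI := (Lp.memLp f).integrable (by norm_num)

theorem ae_mem_volI : ∀ᵐ t ∂volI, t ∈ Icc (0 : ℝ) 1 := ae_restrict_mem measurableSet_Icc

theorem inner_L2I (f g : L2I) : ⟪f, g⟫ = ∫ ξ, f ξ * g ξ ∂volI := by
  rw [L2.inner_def]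
  refine integral_congr_ae (Eventually.of_forall fun ξ => ?_)
  simp [mul_comm]

/-- The primitive `t ↦ ∫₀ᵗ g` of the restriction of `g` to `[0,1]`. -/
noncomputable def primI (g : ℝ → ℝ) (t : ℝ) : ℝ := ∫ s in (0 : ℝ)..t, (Icc (0 : ℝ) 1).indicator g s

theorem integrable_indicator_Icc {g : ℝ → ℝ} (hg : Integrable g volI) :
    Integrable ((Icc (0 : ℝ) 1).indicator g) := (integrable_indicator_iff measurableSet_Icc).2 hg

theorem continuous_primI {g : ℝ → ℝ} (hg : Integrable g volI) : Continuous (primI g) :=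
  intervalIntegral.continuous_primitive
    (fun _ _ => (integrable_indicator_Icc hg).intervalIntegrable) 0

theorem primI_congr {g h : ℝ → ℝ} (H : g =ᵐ[volI] h) : primI g = primI h := by
  have H' : (Icc (0 : ℝ) 1).indicator g =ᵐ[volume] (Icc (0 : ℝ) 1).indicator h :=
    (ae_eq_restrict_iff_indicator_ae_eq measurableSet_Icc).1 H
  funext t
  refine intervalIntegral.integral_congr_ae ?_
  filter_upwards [H'] with s hs _ using hs

theorem primI_zero (g : ℝ → ℝ) : primI g 0 = 0 := intervalIntegral.integral_same

theorem primI_eq_intervalIntegral (g : ℝ → ℝ) {t : ℝ} (ht : t ∈ Icc (0 : ℝ) 1) :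
    primI g t = ∫ s in (0 : ℝ)..t, g s := by
  refine intervalIntegral.integral_congr fun s hs => ?_
  rw [uIcc_of_le ht.1] at hs
  exact indicator_of_mem (s := Icc (0 : ℝ) 1) ⟨hs.1, hs.2.trans ht.2⟩ g

theorem integral_volI_indicator_Iic (g : ℝ → ℝ) {t : ℝ} (ht : t ∈ Icc (0 : ℝ) 1) :
    ∫ s, (Iic t).indicator g s ∂volI = ∫ s in (0 : ℝ)..t, g s := by
  rw [integral_indicator measurableSet_Iic, Measure.restrict_restrict measurableSet_Iic,
    intervalIntegral.integral_of_le ht.1, ← integral_Icc_eq_integral_Ioc]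
  congr 2
  ext s
  simp only [mem_inter_iff, mem_Iic, mem_Icc]
  constructor
  · rintro ⟨h1, h2, h3⟩
    exact ⟨h2, h1⟩
  · rintro ⟨h1, h2⟩
    exact ⟨h2, h1, h2.trans ht.2⟩

theorem primI_one (g : ℝ → ℝ) : primI g 1 = ∫ s, g s ∂volI := by
  rw [primI_eq_intervalIntegral g (by simp), integral_volI_eq_interval]

theorem absolutelyContinuous_primI {g : ℝ → ℝ} (hg : Integrable g volI) :
    AbsolutelyContinuousOnInterval (primI g) 0 1 :=
  ((integrable_indicator_Icc hg).intervalIntegrable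
    (a := 0) (b := 1)).absolutelyContinuousOnInterval_intervalIntegral (by simp)

theorem deriv_primI_ae {g : ℝ → ℝ} (hg : Integrable g volI) : deriv (primI g) =ᵐ[volI] g := by
  have h := ((integrable_indicator_Icc hg).intervalIntegrable
    (a := 0) (b := 1)).ae_hasDerivAt_integral
  filter_upwards [ae_restrict_of_ae h, ae_mem_volI] with x hx hx1
  rw [uIcc_of_le zero_le_one] at hx
  have h1 : deriv (primI g) x = (Icc (0 : ℝ) 1).indicator g x := (hx hx1 0 (by simp)).deriv
  rw [h1, indicator_of_mem hx1]

/-- Integration by parts for primitives. -/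
theorem integral_primI_mul {g h : ℝ → ℝ} (hg : Integrable g volI) (hh : Integrable h volI) :
    ∫ ξ, primI g ξ * h ξ ∂volI
      = (∫ ξ, g ξ ∂volI) * (∫ ξ, h ξ ∂volI) - ∫ ξ, g ξ * primI h ξ ∂volI := by
  have e := (absolutelyContinuous_primI hg).integral_mul_deriv_eq_deriv_mul
    (absolutelyContinuous_primI hh)
  rw [← integral_volI_eq_interval, ← integral_volI_eq_interval, primI_one, primI_one,
    primI_zero, zero_mul, sub_zero] at e
  have e1 : ∫ ξ, primI g ξ * h ξ ∂volI = ∫ ξ, primI g ξ * deriv (primI h) ξ ∂volI := by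
    refine integral_congr_ae ?_
    filter_upwards [deriv_primI_ae hh] with ξ hξ
    rw [hξ]
  have e2 : ∫ ξ, g ξ * primI h ξ ∂volI = ∫ ξ, deriv (primI g) ξ * primI h ξ ∂volI := by
    refine integral_congr_ae ?_
    filter_upwards [deriv_primI_ae hg] with ξ hξ
    rw [hξ]
  rw [e1, e2, e]

theorem primI_deriv_test {φ : ℝ → ℝ} (hφ : ContDiff ℝ ∞ φ) (hs : tsupport φ ⊆ Ioo (0 : ℝ) 1)
    {t : ℝ} (ht : t ∈ Icc (0 : ℝ) 1) : primI (deriv φ) t = φ t := by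
  have h0 : φ 0 = 0 := image_eq_zero_of_notMem_tsupport fun h => by simpa using hs h
  rw [primI_eq_intervalIntegral _ ht, intervalIntegral.integral_deriv_eq_sub
    (fun x _ => (hφ.differentiable (by simp)).differentiableAt)
    ((hφ.continuous_deriv (by simp)).intervalIntegrable _ _), h0, sub_zero]

theorem integral_primI_mul_deriv_test {g φ : ℝ → ℝ} (hg : Integrable g volI)
    (hφ : ContDiff ℝ ∞ φ) (hs : tsupport φ ⊆ Ioo (0 : ℝ) 1) :
    ∫ ξ, primI g ξ * deriv φ ξ ∂volI = - ∫ ξ, g ξ * φ ξ ∂volI := by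
  have h1 : φ 1 = 0 := image_eq_zero_of_notMem_tsupport fun h => by simpa using hs h
  rw [integral_primI_mul hg
    ((hφ.continuous_deriv (by simp)).continuousOn.integrableOn_compact isCompact_Icc),
    ← primI_one (deriv φ), primI_deriv_test hφ hs (by simp), h1, mul_zero, zero_sub]
  congr 1
  refine integral_congr_ae ?_
  filter_upwards [ae_mem_volI] with t ht
  rw [primI_deriv_test hφ hs ht]

end Primitive

/-! ### The Volterra operator and the structure of `H¹([0,1])` -/

section Volterra

theorem memLp_volI_of_continuous {g : ℝ → ℝ} (hg : Continuous g) (p : ℝ≥0∞) : MemLp g p volI := by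
  obtain ⟨C, hC⟩ := isCompact_Icc.exists_bound_of_continuousOn (s := Icc (0 : ℝ) 1) hg.continuousOn
  exact MemLp.of_bound hg.aestronglyMeasurable C
    ((ae_restrict_iff' measurableSet_Icc).2 (Eventually.of_forall hC))

theorem memLp_volterraKernel (μ t : ℝ) :
    MemLp ((Iic t).indicator fun s => Real.exp (-μ * (t - s))) 2 volI :=
  (memLp_volI_of_continuous (by fun_prop) 2).indicator measurableSet_Iic

/-- The kernel `s ↦ exp (-μ (t - s))`, `s ≤ t`, of the weighted Volterra operator. -/
noncomputable def volterraKernel (μ t : ℝ) : L2I := (memLp_volterraKernel μ t).toLp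

/-- Writing the weighted primitive as an inner product makes pointwise bounds available through
Cauchy-Schwarz. -/
theorem inner_volterraKernel (μ : ℝ) {t : ℝ} (ht : t ∈ Icc (0 : ℝ) 1) (f : L2I) :
    ⟪volterraKernel μ t, f⟫ = Real.exp (-μ * t) * primI (fun s => Real.exp (μ * s) * f s) t := by
  rw [inner_L2I, primI_eq_intervalIntegral _ ht, ← integral_volI_indicator_Iic _ ht,
    ← integral_const_mul]
  refine integral_congr_ae ?_
  filter_upwards [(memLp_volterraKernel μ t).coeFn_toLp] with s hs
  rw [volterraKernel, hs]
  by_cases h : s ∈ Iic t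
  · rw [indicator_of_mem h, indicator_of_mem h, ← mul_assoc, ← Real.exp_add]
    ring_nf
  · rw [indicator_of_notMem h, indicator_of_notMem h, zero_mul, mul_zero]

theorem norm_sq_volterraKernel (μ : ℝ) {t : ℝ} (ht : t ∈ Icc (0 : ℝ) 1) :
    ‖volterraKernel μ t‖ ^ 2 = ∫ s in (0 : ℝ)..t, Real.exp (-(2 * μ) * (t - s)) := by
  rw [← real_inner_self_eq_norm_sq, inner_L2I, ← integral_volI_indicator_Iic _ ht]
  refine integral_congr_ae ?_
  filter_upwards [(memLp_volterraKernel μ t).coeFn_toLp] with s hs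
  rw [volterraKernel, hs]
  by_cases h : s ∈ Iic t
  · rw [indicator_of_mem h, indicator_of_mem h, ← Real.exp_add]
    ring_nf
  · rw [indicator_of_notMem h, indicator_of_notMem h, zero_mul]

theorem norm_volterraKernel_zero_le {t : ℝ} (ht : t ∈ Icc (0 : ℝ) 1) :
    ‖volterraKernel 0 t‖ ≤ 1 := by
  have h := norm_sq_volterraKernel 0 ht
  simp only [mul_zero, neg_zero, zero_mul, Real.exp_zero, intervalIntegral.integral_const,
    sub_zero, smul_eq_mul, mul_one] at h
  exact (sq_le_one_iff₀ (norm_nonneg _)).1 (h.trans_le ht.2)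

/-- The squared norm is `(1 - exp(-2μt)) / (2μ)`. Its decay in `μ`, uniform in `t`, is what makes
the weighted Volterra operator small. -/
theorem norm_sq_volterraKernel_le {μ : ℝ} (hμ : 0 < μ) {t : ℝ} (ht : t ∈ Icc (0 : ℝ) 1) :
    ‖volterraKernel μ t‖ ^ 2 ≤ 1 / (2 * μ) := by
  have hd : ∀ s ∈ uIcc 0 t, HasDerivAt (fun s => 1 / (2 * μ) * Real.exp (-(2 * μ) * (t - s)))
      (Real.exp (-(2 * μ) * (t - s))) s := fun s _ => by
    have h := ((((hasDerivAt_id s).const_sub t).const_mul (-(2 * μ))).exp).const_mul (1 / (2 * μ))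
    refine h.congr_deriv ?_
    rw [id]
    field_simp
  rw [norm_sq_volterraKernel μ ht, intervalIntegral.integral_eq_sub_of_hasDerivAt hd
    (Continuous.intervalIntegrable (by fun_prop) _ _)]
  simp only [sub_self, mul_zero, Real.exp_zero, mul_one]
  linarith [mul_pos (one_div_pos.2 (mul_pos two_pos hμ)) (Real.exp_pos (-(2 * μ) * (t - 0)))]

theorem primI_eq_inner (f : L2I) {t : ℝ} (ht : t ∈ Icc (0 : ℝ) 1) :
    primI f t = ⟪volterraKernel 0 t, f⟫ := by
  rw [inner_volterraKernel 0 ht]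
  simp

theorem memLp_primI (f : L2I) : MemLp (primI f) 2 volI :=
  memLp_volI_of_continuous (continuous_primI (integrable_volI_of_L2I f)) 2

/-- The interval has total mass one, so an essential bound is also an `L²` bound. -/
theorem norm_le_of_ae_bound_volI {f : L2I} {C : ℝ} (hC : 0 ≤ C) (h : ∀ᵐ t ∂volI, ‖f t‖ ≤ C) :
    ‖f‖ ≤ C := by
  have h1 : volI.real univ = 1 := by simp [Measure.real]
  have h2 := Lp.norm_le_of_ae_bound hC h
  rw [show measureUnivNNReal volI = 1 from NNReal.coe_injective h1] at h2
  simpa using h2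

/-- The Volterra operator `f ↦ (t ↦ ∫₀ᵗ f)` on `L²([0,1])`. -/
noncomputable def volterra : L2I →L[ℝ] L2I :=
  LinearMap.mkContinuous
    { toFun := fun f => (memLp_primI f).toLp (primI f)
      map_add' := fun f g => by
        refine Lp.ext ?_
        filter_upwards [(memLp_primI f).coeFn_toLp, (memLp_primI g).coeFn_toLp,
          (memLp_primI (f + g)).coeFn_toLp,
          Lp.coeFn_add ((memLp_primI f).toLp _) ((memLp_primI g).toLp _), ae_mem_volI] with t h1 h2 h3 h4 ht
        rw [h3, h4, Pi.add_apply, h1, h2, primI_eq_inner _ ht, primI_eq_inner _ ht,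
          primI_eq_inner _ ht, inner_add_right]
      map_smul' := fun r f => by
        refine Lp.ext ?_
        filter_upwards [(memLp_primI f).coeFn_toLp, (memLp_primI (r • f)).coeFn_toLp,
          Lp.coeFn_smul r ((memLp_primI f).toLp _), ae_mem_volI] with t h1 h2 h3 ht
        rw [h2, RingHom.id_apply, h3, Pi.smul_apply, h1, primI_eq_inner _ ht, primI_eq_inner _ ht,
          inner_smul_right]
        rfl }
    1 fun f => by
      refine norm_le_of_ae_bound_volI (by positivity) ?_
      filter_upwards [(memLp_primI f).coeFn_toLp, ae_mem_volI] with t h ht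
      change ‖(memLp_primI f).toLp (primI f) t‖ ≤ _
      rw [h, primI_eq_inner _ ht]
      exact (norm_inner_le_norm _ _).trans (by gcongr; exact norm_volterraKernel_zero_le ht)

theorem coeFn_volterra (f : L2I) : volterra f =ᵐ[volI] primI f := (memLp_primI f).coeFn_toLp

/-- The constant function `1`. -/
noncomputable def oneI : L2I := Lp.const 2 volI 1

theorem coeFn_oneI : oneI =ᵐ[volI] fun _ => (1 : ℝ) := Lp.coeFn_const (p := 2) (μ := volI) (1 : ℝ)

theorem inner_oneI (f : L2I) : ⟪oneI, f⟫ = ∫ ξ, f ξ ∂volI := by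
  rw [inner_L2I]
  refine integral_congr_ae ?_
  filter_upwards [coeFn_oneI] with ξ h
  rw [h, one_mul]

/-- Integration by parts for the Volterra operator. -/
theorem inner_volterra (f g : L2I) :
    ⟪volterra f, g⟫ = ⟪oneI, f⟫ * ⟪oneI, g⟫ - ⟪f, volterra g⟫ := by
  rw [inner_oneI, inner_oneI, inner_L2I, inner_L2I]
  have e1 : ∫ ξ, volterra f ξ * g ξ ∂volI = ∫ ξ, primI f ξ * g ξ ∂volI := by
    refine integral_congr_ae ?_
    filter_upwards [coeFn_volterra f] with ξ h
    rw [h]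
  have e2 : ∫ ξ, f ξ * volterra g ξ ∂volI = ∫ ξ, f ξ * primI g ξ ∂volI := by
    refine integral_congr_ae ?_
    filter_upwards [coeFn_volterra g] with ξ h
    rw [h]
  rw [e1, e2, integral_primI_mul (integrable_volI_of_L2I f) (integrable_volI_of_L2I g)]

theorem hasWeakDeriv_volterra (f : L2I) : HasWeakDeriv (volterra f) f := by
  intro φ hφ _ hs
  rw [← integral_primI_mul_deriv_test (integrable_volI_of_L2I f) hφ hs]
  refine integral_congr_ae ?_
  filter_upwards [coeFn_volterra f] with ξ h
  rw [h]

theorem hasWeakDeriv_oneI : HasWeakDeriv oneI 0 := by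
  intro φ hφ _ hs
  have h1 : φ 1 = 0 := image_eq_zero_of_notMem_tsupport fun h => by simpa using hs h
  have e1 : ∫ ξ, oneI ξ * deriv φ ξ ∂volI = ∫ ξ, deriv φ ξ ∂volI := by
    refine integral_congr_ae ?_
    filter_upwards [coeFn_oneI] with ξ h
    rw [h, one_mul]
  have e2 : ∫ ξ, (0 : L2I) ξ * φ ξ ∂volI = ∫ _, (0 : ℝ) ∂volI := by
    refine integral_congr_ae ?_
    filter_upwards [Lp.coeFn_zero ℝ 2 volI] with ξ h
    rw [h, Pi.zero_apply, zero_mul]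
  rw [e1, e2, integral_zero, ← primI_one, primI_deriv_test hφ hs (by simp), h1, neg_zero]

theorem hasWeakDeriv_smul_oneI_add_volterra (k : ℝ) (g : L2I) :
    HasWeakDeriv (k • oneI + volterra g) g := by
  simpa using (hasWeakDeriv_oneI.smul k).add (hasWeakDeriv_volterra g)

/-- The difference `f - Vg` has weak derivative zero and is therefore constant. In the resulting
form `k + Vg`, boundary values and weak derivative can be read off. -/
theorem HasWeakDeriv.exists_eq {f g : L2I} (h : HasWeakDeriv f g) :
    ∃ k : ℝ, f = k • oneI + volterra g := by
  obtain ⟨k, hk⟩ := ae_const_of_test (integrable_volI_of_L2I (f - volterra g))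
    fun φ hφ hc hs => by
      have h1 := (h.add ((hasWeakDeriv_volterra g).smul (-1))) φ hφ hc hs
      rw [neg_one_smul, neg_one_smul, ← sub_eq_add_neg, add_neg_cancel] at h1
      have e2 : ∫ ξ, (0 : L2I) ξ * φ ξ ∂volI = ∫ _, (0 : ℝ) ∂volI := by
        refine integral_congr_ae ?_
        filter_upwards [Lp.coeFn_zero ℝ 2 volI] with ξ h
        rw [h, Pi.zero_apply, zero_mul]
      rw [h1, e2, integral_zero, neg_zero]
  refine ⟨k, ?_⟩
  rw [← sub_eq_iff_eq_add]
  refine Lp.ext ?_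
  filter_upwards [hk, Lp.coeFn_smul k oneI, coeFn_oneI] with ξ h1 h2 h3
  rw [h1, h2, Pi.smul_apply, h3, smul_eq_mul, mul_one]

theorem evalI_smul_oneI_add_volterra (t : Icc (0 : ℝ) 1) {f : H1I} {k : ℝ} {g : L2I}
    (h : (f : L2I) = k • oneI + volterra g) : evalI t f = k + primI g t := by
  refine evalI_eq t f (g := fun s => k + primI g s)
    (continuous_const.add (continuous_primI (integrable_volI_of_L2I g))).continuousOn ?_
  rw [h]
  filter_upwards [Lp.coeFn_add (k • oneI) (volterra g), Lp.coeFn_smul k oneI, coeFn_oneI,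
    coeFn_volterra g] with ξ h1 h2 h3 h4
  rw [h1, Pi.add_apply, h2, Pi.smul_apply, h3, h4, smul_eq_mul, mul_one]

theorem eval0_eq {f : H1I} {k : ℝ} {g : L2I} (h : (f : L2I) = k • oneI + volterra g) :
    eval0 f = k := by
  rw [evalI_smul_oneI_add_volterra _ h, primI_zero, add_zero]

theorem eval1_eq {f : H1I} {k : ℝ} {g : L2I} (h : (f : L2I) = k • oneI + volterra g) :
    eval1 f = k + ⟪oneI, g⟫ := by
  rw [evalI_smul_oneI_add_volterra _ h, primI_one, inner_oneI]

theorem weakDeriv_eq {f : H1I} {k : ℝ} {g : L2I} (h : (f : L2I) = k • oneI + volterra g) :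
    weakDeriv f = g := by
  refine (hasWeakDeriv_weakDeriv f).unique ?_
  rw [h]
  exact hasWeakDeriv_smul_oneI_add_volterra k g

theorem eq_eval0_smul_oneI_add_volterra (f : H1I) :
    (f : L2I) = eval0 f • oneI + volterra (weakDeriv f) := by
  obtain ⟨k, hk⟩ := (hasWeakDeriv_weakDeriv f).exists_eq
  rw [eval0_eq hk]
  exact hk

end Volterra

/-! ### Multiplication operators and weighted Volterra equations -/

section Multiplication

theorem coeFn_mulI (a : LinfI) (f : L2I) : mulI a f =ᵐ[volI] fun ξ => a ξ * f ξ :=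
  Lp.coeFn_lpSMul a f

theorem norm_mulI_le (a : LinfI) (f : L2I) : ‖mulI a f‖ ≤ ‖a‖ * ‖f‖ := Lp.norm_smul_le a f

/-- Multiplication by a fixed `L^∞`-function as a bounded operator. -/
noncomputable def mulL (a : LinfI) : L2I →L[ℝ] L2I := (mulI a).mkContinuous ‖a‖ (norm_mulI_le a)

theorem mulL_commute (a b : LinfI) : Commute (mulL a) (mulL b) := by
  ext1 f
  refine Lp.ext ?_
  change mulI a (mulI b f) =ᵐ[volI] mulI b (mulI a f)
  filter_upwards [coeFn_mulI a (mulI b f), coeFn_mulI b (mulI a f), coeFn_mulI a f,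
    coeFn_mulI b f] with ξ h1 h2 h3 h4
  rw [h1, h2, h3, h4]
  ring

theorem mulL_mul_eq_one {a b : LinfI} (h : ∀ᵐ ξ ∂volI, a ξ * b ξ = 1) : mulL a * mulL b = 1 := by
  ext1 f
  refine Lp.ext ?_
  change mulI a (mulI b f) =ᵐ[volI] f
  filter_upwards [coeFn_mulI a (mulI b f), coeFn_mulI b f, h] with ξ h1 h2 h3
  rw [h1, h2, ← mul_assoc, h3, one_mul]

theorem mulI_sub_const (c : LinfI) (r : ℝ) (f : L2I) :
    mulI (c - Lp.const ∞ volI r) f = mulI c f - r • f := by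
  refine Lp.ext ?_
  filter_upwards [coeFn_mulI (c - Lp.const ∞ volI r) f, coeFn_mulI c f,
    Lp.coeFn_sub (mulI c f) (r • f), Lp.coeFn_smul r f, Lp.coeFn_sub c (Lp.const ∞ volI r),
    Lp.coeFn_const (p := ∞) (μ := volI) r] with ξ h1 h2 h3 h4 h5 h6
  rw [h1, h3, Pi.sub_apply, h2, h4, h5, Pi.sub_apply, h6, Pi.smul_apply, smul_eq_mul, sub_mul]
  rfl

/-- The weight `exp (μ t)` on `[0,1]`. -/
noncomputable def expI (μ : ℝ) : LinfI :=
  (memLp_volI_of_continuous (g := fun t => Real.exp (μ * t)) (by fun_prop) ∞).toLp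

theorem coeFn_expI (μ : ℝ) : expI μ =ᵐ[volI] fun t => Real.exp (μ * t) :=
  (memLp_volI_of_continuous (by fun_prop) ∞).coeFn_toLp

theorem mulL_expI_mul_mulL_expI_neg (μ : ℝ) : mulL (expI μ) * mulL (expI (-μ)) = 1 := by
  refine mulL_mul_eq_one ?_
  filter_upwards [coeFn_expI μ, coeFn_expI (-μ)] with t h1 h2
  rw [h1, h2, ← Real.exp_add]
  simp

/-- At each `t` the conjugated operator pairs `f` with the kernel of weight `μ`, so Cauchy-Schwarz
gives a uniform pointwise bound. -/
theorem norm_weighted_volterra_le {μ ε : ℝ} (hμ : 0 < μ) (hε : 0 ≤ ε) (h : 1 / (2 * μ) ≤ ε ^ 2) :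
    ‖mulL (expI (-μ)) * volterra * mulL (expI μ)‖ ≤ ε := by
  refine ContinuousLinearMap.opNorm_le_bound _ hε fun f => ?_
  refine norm_le_of_ae_bound_volI (by positivity) ?_
  change ∀ᵐ t ∂volI, ‖mulI (expI (-μ)) (volterra (mulI (expI μ) f)) t‖ ≤ _
  have e : primI (mulI (expI μ) f) = primI (fun s => Real.exp (μ * s) * f s) := primI_congr (by
    filter_upwards [coeFn_mulI (expI μ) f, coeFn_expI μ] with s h1 h2
    rw [h1, h2])
  filter_upwards [coeFn_mulI (expI (-μ)) (volterra (mulI (expI μ) f)), coeFn_expI (-μ),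
    coeFn_volterra (mulI (expI μ) f), ae_mem_volI] with t h1 h2 h3 ht
  rw [h1, h2, h3, e, ← inner_volterraKernel μ ht]
  refine (norm_inner_le_norm _ _).trans ?_
  gcongr
  exact le_of_sq_le_sq ((norm_sq_volterraKernel_le hμ ht).trans h) hε

/-- Volterra equations with bounded local coefficients are uniquely solvable. -/
theorem isUnit_one_add_volterra {B C D : L2I →L[ℝ] L2I} (hB : ∀ e, Commute (mulL e) B)
    (hC : ∀ e, Commute (mulL e) C) (hD : ∀ e, Commute (mulL e) D) :
    IsUnit (1 + (volterra * B + volterra * C * (volterra * D))) := by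
  set M : ℝ := ‖B‖ + ‖C‖ * ‖D‖ with hM
  have hM0 : 0 ≤ M := by positivity
  -- The choice gives both `εM < 1` and `ε ≤ 1`; the latter reduces the quadratic term from `ε²` to
  -- `ε`.
  set ε : ℝ := 1 / (1 + M) with hε
  have hε0 : 0 < ε := by positivity
  have hε1 : ε ≤ 1 := (div_le_one (by positivity)).2 (by linarith)
  have hεM : ε * M < 1 := by
    rw [hε, one_div_mul_eq_div, div_lt_one (by positivity)]
    linarith
  set μ : ℝ := 1 / (2 * ε ^ 2) with hμ
  have hμ0 : 0 < μ := by positivity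
  set E := mulL (expI μ) with hE
  set F := mulL (expI (-μ)) with hF
  have hEF : E * F = 1 := mulL_expI_mul_mulL_expI_neg μ
  have hFE : F * E = 1 := by rw [← hEF]; exact mulL_commute _ _
  set W := F * volterra * E with hW
  have hWn : ‖W‖ ≤ ε := norm_weighted_volterra_le hμ0 hε0.le (by
    rw [hμ]
    field_simp
    rfl)
  have hV : volterra = E * W * F := by
    rw [hW]
    calc volterra = (E * F) * volterra * (E * F) := by rw [hEF, one_mul, mul_one]
      _ = _ := by simp only [mul_assoc]
  -- The coefficients commute with the weights, so conjugation only replaces `V` by the small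
  -- operator `W`, and a Neumann series applies.
  have key : 1 + (volterra * B + volterra * C * (volterra * D))
      = E * (1 - -(W * B + W * C * (W * D))) * F := by
    have e1 : E * W * F * B = E * (W * B) * F := by
      simp only [mul_assoc]
      rw [(hB _).eq]
    have e2 : E * W * F * C * (E * W * F * D) = E * (W * C * (W * D)) * F := by
      calc E * W * F * C * (E * W * F * D) = E * W * (F * C) * E * W * (F * D) := by
            simp only [mul_assoc]
        _ = E * W * (C * F) * E * W * (D * F) := by rw [(hC _).eq, (hD _).eq]
        _ = E * W * C * (F * E) * W * (D * F) := by simp only [mul_assoc]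
        _ = _ := by rw [hFE, mul_one]; simp only [mul_assoc]
    rw [sub_neg_eq_add, mul_add, mul_add, mul_one, add_mul, add_mul, hEF, ← e1, ← e2, ← hV]
  have hEu : IsUnit E := ⟨⟨E, F, hEF, hFE⟩, rfl⟩
  have hFu : IsUnit F := ⟨⟨F, E, hFE, hEF⟩, rfl⟩
  rw [key]
  refine (hEu.mul (isUnit_one_sub_of_norm_lt_one ?_)).mul hFu
  rw [norm_neg]
  calc ‖W * B + W * C * (W * D)‖ ≤ ‖W‖ * ‖B‖ + ‖W‖ * ‖C‖ * (‖W‖ * ‖D‖) := by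
        refine (norm_add_le _ _).trans (add_le_add (norm_mul_le _ _) ?_)
        refine (norm_mul_le _ _).trans ?_
        gcongr <;> exact norm_mul_le _ _
    _ ≤ ε * ‖B‖ + ε * ‖C‖ * (1 * ‖D‖) := by
        gcongr
        exact hWn.trans hε1
    _ = ε * M := by rw [hM]; ring
    _ < 1 := hεM

end Multiplication

/-! ### The differential equation as an integral system, and its solution operator -/

section Solution

/-- `x` solves `(a x')' + b x' + c x = f`, `x(0) = 0`, `(a x')(0) = y`, `x(1) = u`; here `p = x'`
and `q = (a x')'`. -/
def IsHeatSolution (a b c : LinfI) (x : L2I) (u : ℝ) (f : L2I) (y : ℝ) : Prop :=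
  ∃ p q : L2I, x = volterra p ∧ u = ⟪oneI, p⟫ ∧ mulI a p = y • oneI + volterra q ∧
    f = q + mulI b p + mulI c x

variable {a b c : LinfI}

theorem smul_oneI_add_volterra_inj {k k' : ℝ} {g g' : L2I}
    (h : k • oneI + volterra g = k' • oneI + volterra g') : k = k' ∧ g = g' := by
  have h1 := hasWeakDeriv_smul_oneI_add_volterra k g
  let F : H1I := ⟨_, g, h1⟩
  have e1 : (F : L2I) = k • oneI + volterra g := rfl
  have e2 : (F : L2I) = k' • oneI + volterra g' := h
  exact ⟨(eval0_eq e1).symm.trans (eval0_eq e2), (weakDeriv_eq e1).symm.trans (weakDeriv_eq e2)⟩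

/-- The state determines `p = x'`; then `ap` determines `y` and `q`, and these determine `f`. -/
theorem IsHeatSolution.unique {x : L2I} {u u' : ℝ} {f f' : L2I} {y y' : ℝ}
    (h : IsHeatSolution a b c x u f y) (h' : IsHeatSolution a b c x u' f' y') :
    f = f' ∧ y = y' := by
  obtain ⟨p, q, h1, _, h3, h4⟩ := h
  obtain ⟨p', q', h1', _, h3', h4'⟩ := h'
  obtain rfl : p = p' := (smul_oneI_add_volterra_inj (k := 0) (k' := 0) (by
    rw [zero_smul, zero_add, zero_add, ← h1, ← h1'])).2
  obtain ⟨rfl, rfl⟩ := smul_oneI_add_volterra_inj (h3.symm.trans h3')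
  exact ⟨h4.trans h4'.symm, rfl⟩

theorem isHeatSolution_sub_const_iff {x : L2I} {u : ℝ} {f : L2I} {y r : ℝ} :
    IsHeatSolution a b (c - Lp.const ∞ volI r) x u f y
      ↔ IsHeatSolution a b c x u (f + r • x) y := by
  unfold IsHeatSolution
  simp only [mulI_sub_const, add_sub, eq_sub_iff_add_eq]

/-- The initial value problem is solved by a bounded operator. -/
theorem exists_solution_operator {d : LinfI} (had : ∀ᵐ ξ ∂volI, a ξ * d ξ = 1) (b c : LinfI) :
    ∃ Φ : L2I × ℝ →L[ℝ] L2I × ℝ, ∀ x u f y, IsHeatSolution a b c x u f y ↔ (x, u) = Φ (f, y) := by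
  obtain ⟨K, hK⟩ := isUnit_one_add_volterra (B := mulL b * mulL d) (C := mulL c) (D := mulL d)
    (fun e => (mulL_commute e b).mul_right (mulL_commute e d)) (fun e => mulL_commute e c)
    (fun e => mulL_commute e d)
  have had1 : ∀ f, mulI a (mulI d f) = f := fun f =>
    congrArg (fun T : L2I →L[ℝ] L2I => T f) (mulL_mul_eq_one had)
  have had2 : ∀ f, mulI d (mulI a f) = f := fun f =>
    congrArg (fun T : L2I →L[ℝ] L2I => T f)
      (mulL_mul_eq_one (a := d) (b := a) (by simpa only [mul_comm] using had))
  have hKa : ∀ w, (K : L2I →L[ℝ] L2I) w = w + (volterra (mulI b (mulI d w))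
      + volterra (mulI c (volterra (mulI d w)))) := fun w => by rw [hK]; rfl
  let P : L2I × ℝ →L[ℝ] L2I := (mulL d * (K⁻¹ : (L2I →L[ℝ] L2I)ˣ)).comp
    (volterra.comp (ContinuousLinearMap.fst ℝ L2I ℝ)
      + (ContinuousLinearMap.toSpanSingleton ℝ oneI).comp (ContinuousLinearMap.snd ℝ L2I ℝ))
  have hP : ∀ f y, P (f, y)
      = mulI d ((K⁻¹ : (L2I →L[ℝ] L2I)ˣ).1 (volterra f + y • oneI)) := fun f y => rfl
  refine ⟨(volterra.comp P).prod ((innerSL ℝ oneI).comp P), fun x u f y => ?_⟩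
  -- Eliminating `q = f - bp - cVp` and taking `w = ap` as unknown turns the system into `Kw = Vf +
  -- y`; finally `p = dw`.
  have hp : ∀ p, (mulI a p = y • oneI + volterra (f - mulI b p - mulI c (volterra p)))
      ↔ p = P (f, y) := fun p => by
    have e1 : (mulI a p = y • oneI + volterra (f - mulI b p - mulI c (volterra p)))
        ↔ K.1 (mulI a p) = volterra f + y • oneI := by
      rw [hKa, had2, map_sub, map_sub]
      constructor
      · intro h
        rw [h]
        abel
      · intro h
        rw [← eq_sub_iff_add_eq] at h
        rw [h]
        abel
    rw [e1, hP]
    constructor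
    · intro h
      rw [← h, ← mul_apply_eq_comp, K.inv_mul, one_apply_eq_self, had2]
    · rintro rfl
      rw [had1, ← mul_apply_eq_comp, K.mul_inv, one_apply_eq_self]
  change _ ↔ (x, u) = (volterra (P (f, y)), ⟪oneI, P (f, y)⟫)
  rw [Prod.mk.injEq]
  constructor
  · rintro ⟨p, q, rfl, rfl, h3, rfl⟩
    rw [← (hp p).1 (by rw [h3]; congr 2; abel)]
    exact ⟨rfl, rfl⟩
  · rintro ⟨rfl, rfl⟩
    exact ⟨P (f, y), _, rfl, rfl, (hp _).2 rfl, by abel⟩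

theorem isHeatSolution_heatAB (v : (heatAB a b c).domain) :
    IsHeatSolution a b c v.1.1 v.1.2 (heatAB a b c v) (heatCD a b c v) := by
  obtain ⟨h1, h2⟩ : ((heatState a v).1 : L2I) = v.1.1 ∧ eval1 (heatState a v).1 = v.1.2 :=
    v.2.choose_spec
  set x := heatState a v with hx
  have h0 : eval0 x.1 = 0 := x.2.1
  have h3 := eq_eval0_smul_oneI_add_volterra x.1
  refine ⟨weakDeriv x.1, weakDeriv (heatFlux a x), ?_, ?_, ?_, ?_⟩
  · rw [h0, zero_smul, zero_add] at h3
    rw [← h1, ← h3]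
  · rw [← h2, eval1_eq h3, h0, zero_add]
  · exact eq_eval0_smul_oneI_add_volterra (heatFlux a x)
  · rw [← h1]
    rfl

/-- The representations of `x` and `ap` as a constant plus a primitive put both in `H¹`. Uniqueness
then identifies the values of the two operators. -/
theorem IsHeatSolution.exists_mem_domain {x : L2I} {u : ℝ} {f : L2I} {y : ℝ}
    (h : IsHeatSolution a b c x u f y) :
    ∃ v : (heatAB a b c).domain, v.1 = (x, u) ∧ heatAB a b c v = f ∧ heatCD a b c v = y := by
  have hmem : (x, u) ∈ heatDomain a := by
    obtain ⟨p, q, h1, h2, h3, _⟩ := h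
    have h1' : x = (0 : ℝ) • oneI + volterra p := by rw [zero_smul, zero_add, h1]
    let X : H1I := ⟨x, p, by rw [h1]; exact hasWeakDeriv_volterra p⟩
    have hX : (X : L2I) = (0 : ℝ) • oneI + volterra p := h1'
    refine ⟨⟨X, eval0_eq hX, ?_⟩, rfl, ?_⟩
    · change mulI a (weakDeriv X) ∈ H1I
      rw [weakDeriv_eq hX, h3]
      exact ⟨q, hasWeakDeriv_smul_oneI_add_volterra y q⟩
    · change eval1 X = u
      rw [eval1_eq hX, zero_add, h2]
  refine ⟨⟨(x, u), hmem⟩, rfl, ?_⟩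
  exact (isHeatSolution_heatAB (a := a) (b := b) (c := c) ⟨(x, u), hmem⟩).unique h

theorem mem_graph_heatAB_iff {v : L2I × ℝ} {f : L2I} :
    (v, f) ∈ (heatAB a b c).graph ↔ ∃ y, IsHeatSolution a b c v.1 v.2 f y := by
  rw [LinearPMap.mem_graph_iff]
  constructor
  · rintro ⟨w, rfl, rfl⟩
    exact ⟨_, isHeatSolution_heatAB w⟩
  · rintro ⟨y, h⟩
    obtain ⟨w, h1, h2, _⟩ := h.exists_mem_domain
    exact ⟨w, h1, h2⟩

end Solution

/-! ### Quasi-dissipativity and solvability of the boundary value problem -/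

section Dissipativity

variable {a b c d : LinfI}

theorem ae_abs_le_norm_LinfI (d : LinfI) : ∀ᵐ ξ ∂volI, |d ξ| ≤ ‖d‖ := by
  filter_upwards [ae_le_eLpNormEssSup (f := d) (μ := volI)] with ξ h
  rw [← eLpNorm_exponent_top] at h
  have h1 := ENNReal.toReal_mono (Lp.eLpNorm_ne_top d) h
  rwa [toReal_enorm, ← Lp.norm_def] at h1

/-- Pointwise `1 = da ≤ Ma`; this is the coercivity of the diffusion term. -/
theorem norm_sq_le_mul_inner_mulI (ha : ∀ᵐ ξ ∂volI, 0 < a ξ) (had : ∀ᵐ ξ ∂volI, a ξ * d ξ = 1)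
    {M : ℝ} (hM : ‖d‖ ≤ M) (p : L2I) : ‖p‖ ^ 2 ≤ M * ⟪mulI a p, p⟫ := by
  rw [← real_inner_self_eq_norm_sq, inner_L2I, inner_L2I, ← integral_const_mul]
  have hi : ∀ f g : L2I, Integrable (fun ξ => f ξ * g ξ) volI := fun f g =>
    (Lp.memLp f).integrable_mul (Lp.memLp g)
  refine integral_mono_ae (hi _ _) ((hi _ _).const_mul M) ?_
  filter_upwards [ha, had, ae_abs_le_norm_LinfI d, coeFn_mulI a p] with ξ h1 h2 h3 h4
  simp only [h4]
  have h5 : 1 ≤ M * a ξ := by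
    rw [← h2, mul_comm]
    exact mul_le_mul_of_nonneg_right ((le_abs_self _).trans (h3.trans hM)) h1.le
  nlinarith [mul_le_mul_of_nonneg_right h5 (mul_self_nonneg (p ξ))]

/-- The main operator is quasi-dissipative. -/
theorem exists_inner_le_of_isHeatSolution (ha : ∀ᵐ ξ ∂volI, 0 < a ξ)
    (had : ∀ᵐ ξ ∂volI, a ξ * d ξ = 1) (b c : LinfI) :
    ∃ κ : ℝ, ∀ x f y, IsHeatSolution a b c x 0 f y → ⟪f, x⟫ ≤ κ * ‖x‖ ^ 2 := by
  -- The added `1` makes `M` strictly positive, so it can be cancelled in the Young inequality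
  -- below.
  set M : ℝ := ‖d‖ + 1 with hM
  have hM0 : 0 < M := by positivity
  refine ⟨M * ‖b‖ ^ 2 + ‖c‖, ?_⟩
  rintro x f y ⟨p, q, rfl, h2, h3, rfl⟩
  -- Since `∫ p = x(1) = 0`, the boundary term and the contribution of the constant `y` both vanish.
  have e1 : ⟪q, volterra p⟫ = -⟪mulI a p, p⟫ := by
    have h := inner_volterra q p
    rw [← h2, mul_zero, zero_sub] at h
    rw [h3, inner_add_left, real_inner_smul_left, ← h2, h]
    ring
  have e2 : ⟪mulI b p, volterra p⟫ ≤ ‖b‖ * ‖p‖ * ‖volterra p‖ :=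
    (real_inner_le_norm _ _).trans
      (mul_le_mul_of_nonneg_right (norm_mulI_le b p) (norm_nonneg _))
  have e3 : ⟪mulI c (volterra p), volterra p⟫ ≤ ‖c‖ * ‖volterra p‖ * ‖volterra p‖ :=
    (real_inner_le_norm _ _).trans
      (mul_le_mul_of_nonneg_right (norm_mulI_le c _) (norm_nonneg _))
  have e4 := norm_sq_le_mul_inner_mulI ha had (show ‖d‖ ≤ M by linarith) p
  rw [inner_add_left, inner_add_left, e1]
  set s := ‖volterra p‖
  -- Young's inequality absorbs the advection term into the diffusion term, using `‖p‖² ≤ M⟪ap, p⟫`.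
  have e5 : ‖b‖ * ‖p‖ * s ≤ ⟪mulI a p, p⟫ + M * ‖b‖ ^ 2 * s ^ 2 := by
    refine le_of_mul_le_mul_left ?_ hM0
    nlinarith [sq_nonneg (‖p‖ - M * ‖b‖ * s), sq_nonneg (M * ‖b‖ * s), sq_nonneg ‖p‖]
  nlinarith

/-- The main operator is quasi-dissipative with some bound `κ`, and for `r > κ` the boundary value
problem `(a x')' + b x' + (c - r) x = f`, `x(0) = 0`, `x(1) = u` is solvable. -/
theorem exists_inner_le_and_forall_exists_solution (ha : ∀ᵐ ξ ∂volI, 0 < a ξ)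
    (had : ∀ᵐ ξ ∂volI, a ξ * d ξ = 1) (b c : LinfI) :
    ∃ κ : ℝ, (∀ x f y, IsHeatSolution a b c x 0 f y → ⟪f, x⟫ ≤ κ * ‖x‖ ^ 2) ∧
      ∀ r, κ < r → ∀ (f : L2I) (u : ℝ), ∃ x y, IsHeatSolution a b c x u (f + r • x) y := by
  obtain ⟨κ, hκ⟩ := exists_inner_le_of_isHeatSolution ha had b c
  refine ⟨κ, hκ, fun r hr f u => ?_⟩
  obtain ⟨Φ, hΦ⟩ := exists_solution_operator had b (c - Lp.const ∞ volI r)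
  -- Otherwise the solution for data `(0, 1)` satisfies `Ax = rx` with `r > κ`, hence is zero. But
  -- the zero state has flux `0`, not `1`.
  have hne : (Φ (0, 1)).2 ≠ 0 := by
    intro h0
    have h1 := (hΦ (Φ (0, 1)).1 0 0 1).2 (by rw [← h0])
    have h2 := hκ _ _ _ (isHeatSolution_sub_const_iff.1 h1)
    rw [zero_add, real_inner_smul_left, real_inner_self_eq_norm_sq] at h2
    have h3 : ‖(Φ (0, 1)).1‖ ^ 2 ≤ 0 := by nlinarith [sq_nonneg ‖(Φ (0, 1)).1‖]
    have h4 : (Φ (0, 1)).1 = 0 :=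
      norm_eq_zero.1 (pow_eq_zero_iff two_ne_zero |>.1 (le_antisymm h3 (sq_nonneg _)))
    rw [h4] at h1
    have h5 := (hΦ 0 0 0 0).2 (by
      rw [show ((0 : L2I), (0 : ℝ)) = 0 from rfl, map_zero])
    exact one_ne_zero (h1.unique h5).2
  -- The endpoint value is affine in the initial flux, and `k` is the flux that hits `u`.
  set k := (u - (Φ (f, 0)).2) / (Φ (0, 1)).2 with hk
  refine ⟨(Φ (f, k)).1, k, isHeatSolution_sub_const_iff.1 ((hΦ _ _ _ _).2 ?_)⟩
  have e : Φ (f, k) = Φ (f, 0) + k • Φ (0, 1) := by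
    rw [← map_smul, ← map_add]
    simp
  refine Prod.ext rfl ?_
  rw [e, Prod.snd_add, Prod.smul_snd, smul_eq_mul, hk, div_mul_cancel₀ _ hne]
  ring

end Dissipativity

/-! ### Closedness, boundedness of the output, and bijectivity -/

section SystemNode

variable {a b c : LinfI}

theorem heatAB_isClosed_and_bounded {Φ : L2I × ℝ →L[ℝ] L2I × ℝ}
    (hΦ : ∀ x u f y, IsHeatSolution a b c x u f y ↔ (x, u) = Φ (f, y)) :
    (heatAB a b c).IsClosed ∧ ∃ K : ℝ, ∀ v : (heatAB a b c).domain,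
      ‖heatCD a b c v‖ ≤ K * √(‖v.1.1‖ ^ 2 + ‖v.1.2‖ ^ 2 + ‖heatAB a b c v‖ ^ 2) := by
  have hsplit : ∀ f y, Φ (f, y) = Φ (f, 0) + y • Φ (0, 1) := fun f y => by
    rw [← map_smul, ← map_add]
    simp
  constructor
  -- Eliminating `y` says that `v - Φ(f, 0)` lies on the line spanned by `Φ(0, 1)`; the line is
  -- closed because it is finite-dimensional.
  · have e : ((heatAB a b c).graph : Set ((L2I × ℝ) × L2I))
        = (fun w : (L2I × ℝ) × L2I => w.1 - Φ (w.2, 0)) ⁻¹' (ℝ ∙ Φ (0, 1)) := by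
      ext ⟨v, f⟩
      rw [SetLike.mem_coe, mem_graph_heatAB_iff, mem_preimage, SetLike.mem_coe,
        Submodule.mem_span_singleton]
      refine exists_congr fun y => ?_
      rw [hΦ, hsplit, eq_sub_iff_add_eq, add_comm]
      exact eq_comm
    change IsClosed ((heatAB a b c).graph : Set ((L2I × ℝ) × L2I))
    rw [e]
    refine (Submodule.closed_of_finiteDimensional _).preimage ?_
    fun_prop
  · have hne : Φ (0, 1) ≠ 0 := fun h0 => by
      have h1 := (hΦ 0 0 0 1).2 h0.symm
      have h2 := (hΦ 0 0 0 0).2 (by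
        rw [show ((0 : L2I), (0 : ℝ)) = 0 from rfl, map_zero])
      exact one_ne_zero (h1.unique h2).2
    have hpos : 0 < ‖Φ (0, 1)‖ := norm_pos_iff.2 hne
    refine ⟨(1 + ‖Φ‖) / ‖Φ (0, 1)‖, fun v => ?_⟩
    have h1 := (hΦ _ _ _ _).1 (isHeatSolution_heatAB v)
    rw [hsplit] at h1
    set f := heatAB a b c v
    set y := heatCD a b c v
    set N := √(‖v.1.1‖ ^ 2 + ‖v.1.2‖ ^ 2 + ‖f‖ ^ 2)
    have n1 : ‖v.1.1‖ ≤ N := Real.le_sqrt_of_sq_le (by nlinarith [sq_nonneg ‖v.1.2‖, sq_nonneg ‖f‖])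
    have n2 : ‖v.1.2‖ ≤ N := Real.le_sqrt_of_sq_le (by nlinarith [sq_nonneg ‖v.1.1‖, sq_nonneg ‖f‖])
    have n3 : ‖f‖ ≤ N := Real.le_sqrt_of_sq_le (by
      nlinarith [sq_nonneg ‖v.1.1‖, sq_nonneg ‖v.1.2‖])
    -- Dividing by `‖Φ(0, 1)‖` recovers `|y|` from the state, the input and `f`. The product carries
    -- the maximum norm, so componentwise bounds suffice.
    have h2 : y • Φ (0, 1) = (v.1.1, v.1.2) - Φ (f, 0) := by rw [h1]; abel
    have h3 : ‖y‖ * ‖Φ (0, 1)‖ ≤ N + ‖Φ‖ * N := by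
      rw [← norm_smul, h2]
      refine (norm_sub_le _ _).trans (add_le_add (max_le n1 n2) ((Φ.le_opNorm _).trans ?_))
      gcongr
      exact max_le n3 (by rw [norm_zero]; positivity)
    rw [div_mul_eq_mul_div, le_div_iff₀ hpos]
    linarith

theorem bijective_heatAB_heatCD {Φ : L2I × ℝ →L[ℝ] L2I × ℝ}
    (hΦ : ∀ x u f y, IsHeatSolution a b c x u f y ↔ (x, u) = Φ (f, y)) :
    Function.Bijective fun v : (heatAB a b c).domain => (heatAB a b c v, heatCD a b c v) := by
  constructor
  · intro v w h
    have h1 := (hΦ _ _ _ _).1 (isHeatSolution_heatAB v)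
    have h2 := (hΦ _ _ _ _).1 (isHeatSolution_heatAB w)
    exact Subtype.ext (h1.trans ((congrArg Φ h).trans h2.symm))
  · rintro ⟨f, y⟩
    obtain ⟨v, _, h2, h3⟩ := ((hΦ (Φ (f, y)).1 (Φ (f, y)).2 f y).2 rfl).exists_mem_domain
    exact ⟨v, Prod.ext h2 h3⟩

end SystemNode

theorem mainTheorem10 (a b c : LinfI)
    (ha : ∀ᵐ ξ ∂volI, 0 < a ξ) (ha_inv : MemLp (fun ξ => (a ξ)⁻¹) ∞ volI) :
    IsSystemNode (heatAB a b c) (heatCD a b c) ∧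
      Function.Bijective fun v : (heatAB a b c).domain => (heatAB a b c v, heatCD a b c v) := by
  have had : ∀ᵐ ξ ∂volI, a ξ * (ha_inv.toLp : LinfI) ξ = 1 := by
    filter_upwards [ha, ha_inv.coeFn_toLp] with ξ h1 h2
    rw [h2, mul_inv_cancel₀ h1.ne']
  obtain ⟨Φ, hΦ⟩ := exists_solution_operator had b c
  obtain ⟨hclosed, hbounded⟩ := heatAB_isClosed_and_bounded hΦ
  obtain ⟨κ, hκ, hs⟩ := exists_inner_le_and_forall_exists_solution ha had b c
  refine ⟨⟨hclosed, hbounded, fun u => ?_, ?_⟩, bijective_heatAB_heatCD hΦ⟩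
  · obtain ⟨x, y, h⟩ := hs (κ + 1) (by linarith) 0 u
    obtain ⟨v, hv, _⟩ := h.exists_mem_domain
    exact ⟨x, hv ▸ v.2⟩
  · refine exists_isGenerator_of_quasidissipative (κ := κ) (fun x => ?_) fun r hr f => ?_
    · exact hκ _ _ _ (isHeatSolution_heatAB (a := a) (b := b) (c := c) ⟨(x.1, 0), x.2⟩)
    -- The sign is needed because `rx - Ax = f` means `Ax = -f + rx`.
    · obtain ⟨x, y, h⟩ := hs r hr (-f) 0
      obtain ⟨⟨_, hv⟩, rfl, h2, _⟩ := h.exists_mem_domain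
      refine ⟨⟨x, hv⟩, ?_⟩
      change r • x - heatAB a b c ⟨(x, 0), hv⟩ = f
      rw [h2]
      abel
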